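/- Let $\mathcal{A}_*=\mathbb{F}_2[\xi_1,\xi_2,\dots]$, $|\xi_n|=2^n-1$, be the classical mod $2$ dual Steenrod algebra, with the Hopf algebra structure $\Delta\xi_n=\sum_{i+j=n}\xi_i^{2^j}\otimes\xi_j$ ($\xi_0=1$). For $h:\mathbb{N}\setminus\{0\}\to\mathbb{N}\cup\{\infty\}$ let $J(h)\subset\mathcal{A}_*$ be the ideal generated by the elements $\xi_i^{2^{h(i)}}$, $i\ge 1$, with the convention $x^{2^\infty}=0$. Let $H_\star=H\underline{\mathbb{F}}{}_\star^{\mathbb{Z}/2}=\mathbb{F}_2[a,\sigma^{-1}]\oplus\mathbb{F}_2\{\theta_{i,j}: i,j\ge 0\}$ be the $RO(\mathbb{Z}/2)$-graded coefficient ring, where $|a|=-\alpha$, $|\sigma^{-1}|=1-\alpha$, $|\theta_{i,j}|=(-2-j)+(2+i+j)\alpha$ and $$a\,\theta_{0,j}=0,\quad a\,\theta_{i+1,j}=\theta_{i,j},\quad \sigma^{-1}\theta_{i,0}=0,\quad \sigma^{-1}\theta_{i,j+1}=\theta_{i,j},\quad \theta_{i,j}\theta_{k,l}=0.$$ Let $\mathcal{A}_\star=H_\star[\xi_{i+1},\tau_i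 : i\ge 0]/(\tau_i^2=a\tau_{i+1}+\eta_R(\sigma^{-1})\xi_{i+1})$ be the $\mathbb{Z}/2$-equivariant dual Steenrod algebra, where $|\xi_i|=(2^i-1)(1+\alpha)$ and $|\tau_i|=(2^i-1)(1+\alpha)+1$. The pair $(H_\star,\mathcal{A}_\star)$ is an $RO(\mathbb{Z}/2)$-graded Hopf algebroid, with left unit the inclusion of $H_\star$, right unit given by $$\eta_R(a)=a,\qquad \eta_R(\sigma^{-1})=\sigma^{-1}+a\tau_0,\qquad \eta_R(\theta_{i,j})=\sum_{k=0}^{i}\binom{j+k}{k}\theta_{i-k,j+k}\tau_0^k,$$ counit given by $\epsilon(\xi_n)=0$ $(n\ge1)$ and $\epsilon(\tau_n)=0$, and coproduct given by $$\Delta\xi_n=\sum_{i+j=n}\xi_i^{2^j}\otimes\xi_j,\qquad \Delta\tau_n=\sum_{i+j=n}\xi_i^{2^j}\otimes\tau_j+\tau_n\otimes 1 .$$ For $h$ as above let $I(h,0)\subset\mathcal{A}_\star$ be the ideal generated by the elements $\xi_i^{2^{h(i)}}$, $i\ge1$, and $\tau_i$, $i\ge 0$. A quotient Hopf algebra of $\mathcal{A}_*$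 is a quotient $\mathcal{A}_*/J$ by a homogeneous Hopf ideal $J$. A quotient Hopf algebroid of $\mathcal{A}_\star$ is a quotient $\mathcal{A}_\star/I$ by a homogeneous Hopf algebroid ideal $I$, that is, $\epsilon(I)=0$, $\Delta(I)\subset I\otimes_{H_\star}\mathcal{A}_\star+\mathcal{A}_\star\otimes_{H_\star}I$ and $c(I)\subset I$, where $c$ is the antipode. Order both sets of quotients by inclusion of ideals. Then every quotient Hopf algebra of $\mathcal{A}_*$ is $\mathcal{A}_*/J(h)$ for a unique $h$, and the assignment $$\mathcal{A}_*/J(h)\longmapsto\mathcal{A}_\star/I(h,0)$$ is a well-defined injection of partially ordered sets from the quotient Hopf algebras of $\mathcal{A}_*$ to the quotient Hopf algebroids of $\mathcal{A}_\star$: it is injective, and it preserves and reflects the order. -/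

import Mathlib

open scoped TensorProduct

noncomputable section

/-! ## A convolution of sequences in a commutative ring of characteristic two -/

namespace SeqConv

open Finset.HasAntidiagonal (antidiagonal mem_antidiagonal)

variable {R : Type} [CommRing R]

/-- `(x ∗ y)_n = ∑_{k + j = n} x_k ^ (2 ^ j) * y_j`. -/
def conv (x y : ℕ → R) (n : ℕ) : R :=
  ∑ p ∈ antidiagonal n, x p.1 ^ 2 ^ p.2 * y p.2

/-- The sequence `1, 0, 0, …`. -/
def one (R : Type) [CommRing R] (n : ℕ) : R := if n = 0 then 1 else 0

/-- For `x_0 = 1`, the unique sequence `s` with `x ∗ s = y`, by recursion: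
`s_n = y_n - ∑_{i < n} x_{n-i} ^ (2 ^ i) * s_i`. -/
def solve (x y : ℕ → R) (n : ℕ) : R :=
  y n - ∑ i : Fin n, x (n - i) ^ 2 ^ (i : ℕ) * solve x y i
termination_by n
decreasing_by exact i.2

lemma conv_eq_sum (x y : ℕ → R) (n : ℕ) :
    conv x y n = x 0 ^ 2 ^ n * y n + ∑ i : Fin n, x (n - i) ^ 2 ^ (i : ℕ) * y i := by
  have h : conv x y n = ∑ i ∈ Finset.range (n + 1), x (n - i) ^ 2 ^ i * y i := by
    rw [conv, Finset.Nat.sum_antidiagonal_eq_sum_range_succ_mk, ← Finset.sum_range_reflect]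
    refine Finset.sum_congr rfl fun i hi => ?_
    have : i ≤ n := by simpa [Nat.lt_succ_iff] using hi
    have h2 : n - (n - i) = i := by omega
    simp [h2]
  rw [h, Finset.sum_range_succ, add_comm, Finset.sum_range]
  simp

lemma conv_solve (x y : ℕ → R) (hx : x 0 = 1) : conv x (solve x y) = y := by
  funext n
  rw [conv_eq_sum, hx, one_pow, one_mul, solve]
  ring

lemma conv_right_cancel (x y z : ℕ → R) (hx : x 0 = 1) (h : conv x y = conv x z) : y = z := by
  funext n
  induction n using Nat.strong_induction_on with
  | _ n ih =>
    have hn := congrFun h n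
    rw [conv_eq_sum, conv_eq_sum, hx] at hn
    have : ∑ i : Fin n, x (n - i) ^ 2 ^ (i : ℕ) * y i = ∑ i : Fin n, x (n - i) ^ 2 ^ (i : ℕ) * z i :=
      Finset.sum_congr rfl fun i _ => by rw [ih i i.2]
    rw [this] at hn
    simpa using hn

lemma solve_zero (x y : ℕ → R) : solve x y 0 = y 0 := by
  rw [solve]; simp

/-- The iterated Frobenius as a ring homomorphism, when `2 = 0`. -/
def frob (h2 : (2 : R) = 0) (n : ℕ) : R →+* R where
  toFun x := x ^ 2 ^ n
  map_one' := one_pow _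
  map_zero' := by simp
  map_mul' x y := mul_pow _ _ _
  map_add' x y := by
    induction n with
    | zero => simp
    | succ n ih =>
      rw [pow_succ, pow_mul, pow_mul, pow_mul, ih]
      linear_combination (x ^ 2 ^ n * y ^ 2 ^ n) * h2

lemma frob_apply (h2 : (2 : R) = 0) (n : ℕ) (x : R) : frob h2 n x = x ^ 2 ^ n := rfl

lemma conv_assoc (h2 : (2 : R) = 0) (x y z : ℕ → R) :
    conv (conv x y) z = conv x (conv y z) := by
  funext n
  have hpow : ∀ (m i : ℕ), conv x y m ^ 2 ^ i =
      ∑ p ∈ antidiagonal m, x p.1 ^ 2 ^ (p.2 + i) * y p.2 ^ 2 ^ i := by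
    intro m i
    rw [← frob_apply h2, conv, map_sum]
    refine Finset.sum_congr rfl fun p _ => ?_
    rw [frob_apply, mul_pow, ← pow_mul, ← pow_add]
  have h1 : conv (conv x y) z n = ∑ q ∈ antidiagonal n, ∑ p ∈ antidiagonal q.1,
      x p.1 ^ 2 ^ (p.2 + q.2) * (y p.2 ^ 2 ^ q.2 * z q.2) := by
    rw [conv]
    refine Finset.sum_congr rfl fun q _ => ?_
    rw [hpow, Finset.sum_mul]
    exact Finset.sum_congr rfl fun p _ => by ring
  have h3 : conv x (conv y z) n = ∑ q ∈ antidiagonal n, ∑ p ∈ antidiagonal q.2,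
      x q.1 ^ 2 ^ (p.1 + p.2) * (y p.1 ^ 2 ^ p.2 * z p.2) := by
    rw [conv]
    refine Finset.sum_congr rfl fun q _ => ?_
    rw [conv, Finset.mul_sum]
    refine Finset.sum_congr rfl fun p hp => ?_
    rw [mem_antidiagonal.mp hp]
  rw [h1, h3, Finset.sum_sigma', Finset.sum_sigma']
  refine Finset.sum_nbij' (fun s => ⟨(s.2.1, s.2.2 + s.1.2), (s.2.2, s.1.2)⟩)
    (fun s => ⟨(s.1.1 + s.2.1, s.2.2), (s.1.1, s.2.1)⟩) ?_ ?_ ?_ ?_ ?_ <;>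
  · rintro ⟨⟨_, _⟩, ⟨_, _⟩⟩ h
    simp_all [Finset.mem_sigma, mem_antidiagonal]
    try omega

lemma conv_one (x : ℕ → R) (n : ℕ) : conv x (one R) n = x n := by
  rw [conv, Finset.sum_eq_single (n, 0)]
  · simp [one]
  · rintro ⟨k, j⟩ h hne
    have : j ≠ 0 := by
      rintro rfl
      simp_all
    simp [one, this]
  · simp

lemma one_conv (y : ℕ → R) : conv (one R) y = y := by
  funext n
  rw [conv, Finset.sum_eq_single (0, n)]
  · simp [one]
  · rintro ⟨k, j⟩ h hne
    have : k ≠ 0 := by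
      rintro rfl
      simp_all
    simp [one, this]
  · simp

lemma conv_add (x y z : ℕ → R) (n : ℕ) : conv x (fun i => y i + z i) n = conv x y n + conv x z n := by
  simp only [conv, mul_add, Finset.sum_add_distrib]

lemma map_conv {S : Type} [CommRing S] (f : R →+* S) (x y : ℕ → R) (n : ℕ) :
    f (conv x y n) = conv (fun i => f (x i)) (fun i => f (y i)) n := by
  simp [conv]

/-- If `x_0 = 1`, the right inverse of `x` is also a left inverse. -/
lemma solve_conv (h2 : (2 : R) = 0) (x : ℕ → R) (hx : x 0 = 1) :
    conv (solve x (one R)) x = one R := by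
  set c := solve x (one R) with hc
  have hc0 : c 0 = 1 := by rw [hc, solve_zero]; simp [one]
  have h1 : conv x c = one R := conv_solve _ _ hx
  have hcd : conv c (solve c (one R)) = one R := conv_solve _ _ hc0
  have : x = solve c (one R) := by
    calc x = conv x (one R) := (funext (conv_one x)).symm
      _ = conv x (conv c (solve c (one R))) := by rw [hcd]
      _ = conv (conv x c) (solve c (one R)) := (conv_assoc h2 _ _ _).symm
      _ = solve c (one R) := by rw [h1, one_conv]
  conv_lhs => rw [this]
  exact hcd

/-- Compatibility of the convolution with relations `t_i² = a t_{i+1} + v y_{i+1}`. -/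
lemma conv_sq (h2 : (2 : R) = 0) (a v : R) (x y t : ℕ → R)
    (ht : ∀ i, t i ^ 2 = a * t (i + 1) + v * y (i + 1)) (n : ℕ) :
    conv x t n ^ 2 =
      a * conv x t (n + 1) + v * conv x y (n + 1) - x (n + 1) * (a * t 0 + v * y 0) := by
  have hs : ∀ z : ℕ → R, conv x z (n + 1) = x (n + 1) * z 0 +
      ∑ p ∈ antidiagonal n, x p.1 ^ 2 ^ (p.2 + 1) * z (p.2 + 1) := by
    intro z
    rw [conv, Finset.Nat.sum_antidiagonal_succ']
    simp
  have hq : conv x t n ^ 2 = ∑ p ∈ antidiagonal n, x p.1 ^ 2 ^ (p.2 + 1) * t p.2 ^ 2 := by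
    have := frob_apply h2 1 (conv x t n)
    rw [pow_one] at this
    rw [← this, conv, map_sum]
    refine Finset.sum_congr rfl fun p _ => ?_
    rw [frob_apply, mul_pow, ← pow_mul, ← pow_add, pow_one]
  rw [hs t, hs y, hq]
  simp_rw [ht, mul_add, Finset.sum_add_distrib, Finset.mul_sum]
  have e1 : ∀ (w : R) (z : ℕ → R),
      ∑ p ∈ antidiagonal n, x p.1 ^ 2 ^ (p.2 + 1) * (w * z (p.2 + 1)) =
      ∑ p ∈ antidiagonal n, w * (x p.1 ^ 2 ^ (p.2 + 1) * z (p.2 + 1)) :=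
    fun w z => Finset.sum_congr rfl fun p _ => by ring
  rw [e1, e1]
  ring

/-- The converse: the relations can be read off from those of `x ∗ t`. -/
lemma sq_of_conv (h2 : (2 : R) = 0) (a v : R) (x y t : ℕ → R) (hx : x 0 = 1)
    (h : ∀ n, conv x t n ^ 2 =
      a * conv x t (n + 1) + v * conv x y (n + 1) - x (n + 1) * (a * t 0 + v * y 0)) (n : ℕ) :
    t n ^ 2 = a * t (n + 1) + v * y (n + 1) := by
  have hs : ∀ (n : ℕ) (z : ℕ → R), conv x z (n + 1) = x (n + 1) * z 0 +
      ∑ p ∈ antidiagonal n, x p.1 ^ 2 ^ (p.2 + 1) * z (p.2 + 1) := by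
    intro n z
    rw [conv, Finset.Nat.sum_antidiagonal_succ']
    simp
  have hq : ∀ n, conv x t n ^ 2 =
      ∑ p ∈ antidiagonal n, x p.1 ^ 2 ^ (p.2 + 1) * t p.2 ^ 2 := by
    intro n
    have := frob_apply h2 1 (conv x t n)
    rw [pow_one] at this
    rw [← this, conv, map_sum]
    refine Finset.sum_congr rfl fun p _ => ?_
    rw [frob_apply, mul_pow, ← pow_mul, ← pow_add, pow_one]
  have key : conv (fun k => x k ^ 2) (fun i => t i ^ 2) =
      conv (fun k => x k ^ 2) (fun i => a * t (i + 1) + v * y (i + 1)) := by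
    funext n
    have e := h n
    rw [hs, hs, hq] at e
    have e1 : conv (fun k => x k ^ 2) (fun i => t i ^ 2) n =
        ∑ p ∈ antidiagonal n, x p.1 ^ 2 ^ (p.2 + 1) * t p.2 ^ 2 := by
      refine Finset.sum_congr rfl fun p _ => ?_
      rw [pow_succ', pow_mul]
    have e2 : conv (fun k => x k ^ 2) (fun i => a * t (i + 1) + v * y (i + 1)) n =
        a * ∑ p ∈ antidiagonal n, x p.1 ^ 2 ^ (p.2 + 1) * t (p.2 + 1) +
        v * ∑ p ∈ antidiagonal n, x p.1 ^ 2 ^ (p.2 + 1) * y (p.2 + 1) := by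
      rw [Finset.mul_sum, Finset.mul_sum, ← Finset.sum_add_distrib]
      refine Finset.sum_congr rfl fun p _ => ?_
      rw [pow_succ' 2 p.2, pow_mul]
      ring
    rw [e1, e2, e]
    ring
  exact congrFun (conv_right_cancel _ _ _ (by simp [hx]) key) n

end SeqConv

/-- `x ^ (2 ^ m)` for `m ∈ ℕ ∪ {∞}`, with the convention `x ^ ∞ = 0`. -/
def powTwo {R : Type} [CommRing R] (x : R) : ℕ∞ → R
  | ⊤ => 0
  | (m : ℕ) => x ^ 2 ^ m

/-! ## The classical mod 2 dual Steenrod algebra -/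

/-- `A_* = 𝔽₂[ξ₁, ξ₂, …]`; the variable `X i` is `ξ_{i+1}`. -/
def ClassicalDual : Type := MvPolynomial ℕ (ZMod 2)

namespace ClassicalDual

open SeqConv

instance : CommRing ClassicalDual := inferInstanceAs (CommRing (MvPolynomial ℕ (ZMod 2)))
instance : Algebra (ZMod 2) ClassicalDual :=
  inferInstanceAs (Algebra (ZMod 2) (MvPolynomial ℕ (ZMod 2)))

/-- The generators `ξ_n`, with `ξ_0 = 1`. -/
def xi : ℕ → ClassicalDual
  | 0 => 1
  | i + 1 => (MvPolynomial.X i : MvPolynomial ℕ (ZMod 2))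

/-- The algebra map with prescribed values on `ξ₁, ξ₂, …`. -/
def lift {S : Type} [CommRing S] [Algebra (ZMod 2) S] (f : ℕ → S) : ClassicalDual →ₐ[ZMod 2] S :=
  (MvPolynomial.aeval (fun i => f (i + 1)) : MvPolynomial ℕ (ZMod 2) →ₐ[ZMod 2] S)

lemma lift_xi {S : Type} [CommRing S] [Algebra (ZMod 2) S] (f : ℕ → S) (hf : f 0 = 1) (n : ℕ) :
    lift f (xi n) = f n := by
  cases n with
  | zero => rw [hf]; exact map_one _
  | succ n => exact MvPolynomial.aeval_X _ _

lemma algHom_ext' {S : Type} [CommRing S] [Algebra (ZMod 2) S] {f g : ClassicalDual →ₐ[ZMod 2] S}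
    (h : ∀ n, f (xi n) = g (xi n)) : f = g :=
  MvPolynomial.algHom_ext (A := S) (f := f) (g := g) fun i => h (i + 1)

lemma two_eq_zero {S : Type} [CommRing S] [Algebra (ZMod 2) S] : (2 : S) = 0 := by
  have := map_ofNat (algebraMap (ZMod 2) S) 2
  rw [← this]
  have h : (OfNat.ofNat 2 : ZMod 2) = 0 := by decide
  rw [h, map_zero]

/-- `Δ ξ_n = ∑_{i + j = n} ξ_i ^ (2 ^ j) ⊗ ξ_j`. -/
def comulHom : ClassicalDual →ₐ[ZMod 2] ClassicalDual ⊗[ZMod 2] ClassicalDual :=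
  lift (conv (fun n => xi n ⊗ₜ 1) (fun n => 1 ⊗ₜ xi n))

/-- `ε ξ_n = 0` for `n ≥ 1`. -/
def counitHom : ClassicalDual →ₐ[ZMod 2] ZMod 2 := lift (one (ZMod 2))

/-- `∑_{i + j = n} ξ_i ^ (2 ^ j) c(ξ_j) = 0` for `n ≥ 1`. -/
def antipodeHom : ClassicalDual →ₐ[ZMod 2] ClassicalDual := lift (solve xi (one ClassicalDual))

lemma comulHom_xi (n : ℕ) :
    comulHom (xi n) = conv (fun n => xi n ⊗ₜ[ZMod 2] 1) (fun n => 1 ⊗ₜ xi n) n := by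
  refine lift_xi _ ?_ n
  simp only [conv, Finset.HasAntidiagonal.antidiagonal]
  simp [xi, Algebra.TensorProduct.one_def]

lemma counitHom_xi (n : ℕ) : counitHom (xi n) = one (ZMod 2) n := lift_xi _ (by simp [one]) n

lemma antipodeHom_xi (n : ℕ) : antipodeHom (xi n) = solve xi (one ClassicalDual) n :=
  lift_xi _ (by rw [solve_zero]; simp [one]) n

lemma map_conv' {S T : Type} [CommRing S] [CommRing T] [Algebra (ZMod 2) S] [Algebra (ZMod 2) T]
    (f : S →ₐ[ZMod 2] T) (x y : ℕ → S) (n : ℕ) :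
    f (conv x y n) = conv (fun i => f (x i)) (fun i => f (y i)) n :=
  map_conv (f : S →+* T) x y n

lemma map_one' {S T : Type} [CommRing S] [CommRing T] [Algebra (ZMod 2) S] [Algebra (ZMod 2) T]
    (f : S →ₐ[ZMod 2] T) (n : ℕ) : f (one S n) = one T n := by
  unfold one; split <;> simp

instance : Bialgebra (ZMod 2) ClassicalDual :=
  Bialgebra.ofAlgHom comulHom counitHom
    (by
      apply algHom_ext'
      intro n
      let i1 : ClassicalDual →ₐ[ZMod 2] ClassicalDual ⊗[ZMod 2] (ClassicalDual ⊗[ZMod 2] ClassicalDual) :=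
        Algebra.TensorProduct.includeLeft
      let i2 : ClassicalDual →ₐ[ZMod 2] ClassicalDual ⊗[ZMod 2] (ClassicalDual ⊗[ZMod 2] ClassicalDual) :=
        Algebra.TensorProduct.includeRight.comp Algebra.TensorProduct.includeLeft
      let i3 : ClassicalDual →ₐ[ZMod 2] ClassicalDual ⊗[ZMod 2] (ClassicalDual ⊗[ZMod 2] ClassicalDual) :=
        Algebra.TensorProduct.includeRight.comp Algebra.TensorProduct.includeRight
      have hL : ((Algebra.TensorProduct.assoc (ZMod 2) (ZMod 2) (ZMod 2) ClassicalDual ClassicalDual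
          ClassicalDual).toAlgHom.comp ((Algebra.TensorProduct.map comulHom (.id _ _)).comp comulHom))
          (xi n) = conv (conv (fun n => i1 (xi n)) (fun n => i2 (xi n))) (fun n => i3 (xi n)) n := by
        rw [AlgHom.comp_apply, AlgHom.comp_apply, comulHom_xi, map_conv', map_conv']
        congr 1
        funext m
        have : (Algebra.TensorProduct.map comulHom (.id (ZMod 2) ClassicalDual))
            (xi m ⊗ₜ[ZMod 2] (1 : ClassicalDual)) =
            Algebra.TensorProduct.includeLeft (R := ZMod 2) (S := ZMod 2) (comulHom (xi m)) := by
          simp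
        rw [this, comulHom_xi, map_conv', map_conv']
        · congr 1
        · funext m
          simp [i3, Algebra.TensorProduct.one_def]
      have hR : ((Algebra.TensorProduct.map (.id (ZMod 2) ClassicalDual) comulHom).comp comulHom)
          (xi n) = conv (fun n => i1 (xi n)) (conv (fun n => i2 (xi n)) (fun n => i3 (xi n))) n := by
        rw [AlgHom.comp_apply, comulHom_xi, map_conv']
        congr 1
        · funext m
          simp [i1, Algebra.TensorProduct.one_def]
        · funext m
          have : (Algebra.TensorProduct.map (.id (ZMod 2) ClassicalDual) comulHom)
              ((1 : ClassicalDual) ⊗ₜ[ZMod 2] xi m) =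
              Algebra.TensorProduct.includeRight (R := ZMod 2) (comulHom (xi m)) := by
            simp
          rw [this, comulHom_xi, map_conv']
          congr 1
      rw [hL, hR, conv_assoc two_eq_zero])
    (by
      apply algHom_ext'
      intro n
      rw [AlgHom.comp_apply, comulHom_xi, map_conv']
      have h1 : (fun i => (Algebra.TensorProduct.map counitHom (.id (ZMod 2) ClassicalDual))
          (xi i ⊗ₜ[ZMod 2] (1 : ClassicalDual))) = one (ZMod 2 ⊗[ZMod 2] ClassicalDual) := by
        funext i
        rw [Algebra.TensorProduct.map_tmul, counitHom_xi, map_one]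
        exact map_one' (Algebra.TensorProduct.includeLeft (R := ZMod 2) (S := ZMod 2)
          (A := ZMod 2) (B := ClassicalDual)) i
      rw [h1, one_conv]
      simp)
    (by
      apply algHom_ext'
      intro n
      rw [AlgHom.comp_apply, comulHom_xi, map_conv']
      have h1 : (fun i => (Algebra.TensorProduct.map (.id (ZMod 2) ClassicalDual) counitHom)
          ((1 : ClassicalDual) ⊗ₜ[ZMod 2] xi i)) = one (ClassicalDual ⊗[ZMod 2] ZMod 2) := by
        funext i
        rw [Algebra.TensorProduct.map_tmul, counitHom_xi, map_one]
        exact map_one' (Algebra.TensorProduct.includeRight (R := ZMod 2)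
          (A := ClassicalDual) (B := ZMod 2)) i
      rw [h1, conv_one]
      simp)

instance : HopfAlgebra (ZMod 2) ClassicalDual :=
  HopfAlgebra.ofAlgHom antipodeHom
    (by
      apply algHom_ext'
      intro n
      have h : (Bialgebra.comulAlgHom (ZMod 2) ClassicalDual) (xi n) = comulHom (xi n) := rfl
      have h' : (Bialgebra.counitAlgHom (ZMod 2) ClassicalDual) (xi n) = counitHom (xi n) := rfl
      rw [AlgHom.comp_apply, AlgHom.comp_apply, h, h', comulHom_xi, map_conv', counitHom_xi, map_one']
      refine Eq.trans ?_ (congrFun (solve_conv two_eq_zero xi rfl) n)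
      congr 1
      · funext m
        refine (Algebra.TensorProduct.lift_tmul _ _ _ _ _).trans ?_
        rw [map_one, mul_one, antipodeHom_xi]
      · funext m
        refine (Algebra.TensorProduct.lift_tmul _ _ _ _ _).trans ?_
        rw [map_one, one_mul, AlgHom.id_apply])
    (by
      apply algHom_ext'
      intro n
      have h : (Bialgebra.comulAlgHom (ZMod 2) ClassicalDual) (xi n) = comulHom (xi n) := rfl
      have h' : (Bialgebra.counitAlgHom (ZMod 2) ClassicalDual) (xi n) = counitHom (xi n) := rfl
      rw [AlgHom.comp_apply, AlgHom.comp_apply, h, h', comulHom_xi, map_conv', counitHom_xi, map_one']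
      refine Eq.trans ?_ (congrFun (conv_solve xi _ rfl) n)
      congr 1
      · funext m
        refine (Algebra.TensorProduct.lift_tmul _ _ _ _ _).trans ?_
        rw [map_one, mul_one, AlgHom.id_apply]
      · funext m
        refine (Algebra.TensorProduct.lift_tmul _ _ _ _ _).trans ?_
        rw [map_one, one_mul, antipodeHom_xi])

/-- The grading of `A_*`, with `|ξ_n| = 2 ^ n - 1`. -/
def gr (d : ℕ) : Submodule (ZMod 2) ClassicalDual :=
  MvPolynomial.weightedHomogeneousSubmodule (ZMod 2) (fun i : ℕ => 2 ^ (i + 1) - 1) d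

instance : GradedAlgebra gr :=
  MvPolynomial.weightedGradedAlgebra (ZMod 2) (fun i : ℕ => 2 ^ (i + 1) - 1)

/-- The ideal `J(h)` generated by the `ξ_i ^ (2 ^ h(i))`, `i ≥ 1`. -/
def J (h : ℕ+ → ℕ∞) : Ideal ClassicalDual :=
  Ideal.span (Set.range fun i : ℕ+ => powTwo (xi i) (h i))

/-- The graded Hopf ideals of `A_*`, ordered by inclusion; `I` stands for the quotient Hopf
algebra `A_* / I`. -/
abbrev QuotientHopfAlgebra : Type :=
  {I : Ideal ClassicalDual // I.IsHopfIdeal (ZMod 2) ∧ I.IsHomogeneous gr}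

end ClassicalDual

/-! ## Hopf algebroids -/

section BiTensor

variable {H A B : Type} [CommRing H] [CommRing A] [CommRing B]

/-- The tensor product `A ⊗_H B`, where `H` acts on `A` through `f` and on `B` through `g`. -/
def BiTensor (f : H →+* A) (g : H →+* B) : Type :=
  @TensorProduct H _ A B _ _ f.toAlgebra.toModule g.toAlgebra.toModule

namespace BiTensor

variable (f : H →+* A) (g : H →+* B)

instance : CommRing (BiTensor f g) :=
  @Algebra.TensorProduct.instCommRing H A B _ _ f.toAlgebra _ g.toAlgebra

/-- `x ↦ x ⊗ 1`. -/
def inl : A →+* BiTensor f g :=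
  letI := f.toAlgebra
  letI := g.toAlgebra
  (Algebra.TensorProduct.includeLeft : A →ₐ[H] A ⊗[H] B).toRingHom

/-- `y ↦ 1 ⊗ y`. -/
def inr : B →+* BiTensor f g :=
  letI := f.toAlgebra
  letI := g.toAlgebra
  (Algebra.TensorProduct.includeRight : B →ₐ[H] A ⊗[H] B).toRingHom

lemma inl_comp_eq : (inl f g).comp f = (inr f g).comp g := by
  let _ := f.toAlgebra
  let _ := g.toAlgebra
  ext h
  exact ((Algebra.TensorProduct.includeLeft : A →ₐ[H] A ⊗[H] B).commutes h).trans
    ((Algebra.TensorProduct.includeRight : B →ₐ[H] A ⊗[H] B).commutes h).symm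

lemma inl_apply_eq (h : H) : inl f g (f h) = inr f g (g h) :=
  RingHom.congr_fun (inl_comp_eq f g) h

variable {f g}

/-- `x ⊗ y ↦ p(x) q(y)`, for ring maps `p` and `q` which agree on `H`. -/
def lift {C : Type} [CommRing C] (p : A →+* C) (q : B →+* C) (h : p.comp f = q.comp g) :
    BiTensor f g →+* C :=
  letI := f.toAlgebra
  letI := g.toAlgebra
  letI := (p.comp f).toAlgebra
  (Algebra.TensorProduct.lift (R := H) (S := H)
    ({ p with commutes' := fun _ => rfl } : A →ₐ[H] C)
    ({ q with commutes' := fun r => (RingHom.congr_fun h r).symm } : B →ₐ[H] C)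
    fun _ _ => Commute.all _ _).toRingHom

lemma lift_inl {C : Type} [CommRing C] (p : A →+* C) (q : B →+* C) (h : p.comp f = q.comp g)
    (x : A) : lift p q h (inl f g x) = p x := by
  let _ := f.toAlgebra
  let _ := g.toAlgebra
  let _ := (p.comp f).toAlgebra
  refine (Algebra.TensorProduct.lift_tmul _ _ _ _ _).trans ?_
  rw [map_one, mul_one]
  rfl

lemma lift_inr {C : Type} [CommRing C] (p : A →+* C) (q : B →+* C) (h : p.comp f = q.comp g)
    (y : B) : lift p q h (inr f g y) = q y := by
  let _ := f.toAlgebra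
  let _ := g.toAlgebra
  let _ := (p.comp f).toAlgebra
  refine (Algebra.TensorProduct.lift_tmul _ _ _ _ _).trans ?_
  rw [map_one, one_mul]
  rfl

end BiTensor

end BiTensor

/-- A Hopf algebroid `(H, A)` of commutative rings: a cogroupoid object. The coproduct takes values
in `A ⊗_H A`, the tensor product along the right unit on the first factor and the left unit on the
second. -/
structure HopfAlgebroid (H A : Type) [CommRing H] [CommRing A] where
  /-- left unit -/
  etaL : H →+* A
  /-- right unit -/
  etaR : H →+* A
  /-- coproduct -/
  comul : A →+* BiTensor etaR etaL
  /-- counit -/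
  counit : A →+* H
  /-- antipode -/
  antipode : A →+* A
  comul_etaL : ∀ h, comul (etaL h) = BiTensor.inl etaR etaL (etaL h)
  comul_etaR : ∀ h, comul (etaR h) = BiTensor.inr etaR etaL (etaR h)
  counit_etaL : counit.comp etaL = RingHom.id H
  counit_etaR : counit.comp etaR = RingHom.id H
  antipode_etaL : antipode.comp etaL = etaR
  antipode_etaR : antipode.comp etaR = etaL
  antipode_antipode : ∀ x, antipode (antipode x) = x
  /-- `(id ⊗ ε) ∘ Δ = id` -/
  counit_right : ∀ x, BiTensor.lift (RingHom.id A) (etaR.comp counit)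
    (by rw [RingHom.comp_assoc, counit_etaL]; rfl) (comul x) = x
  /-- `(ε ⊗ id) ∘ Δ = id` -/
  counit_left : ∀ x, BiTensor.lift (etaL.comp counit) (RingHom.id A)
    (by rw [RingHom.comp_assoc, counit_etaR]; rfl) (comul x) = x
  /-- `(Δ ⊗ id) ∘ Δ = (id ⊗ Δ) ∘ Δ`, as maps to `(A ⊗_H A) ⊗_H A` -/
  coassoc : ∀ x,
    BiTensor.lift (f := etaR) (g := etaL)
      ((BiTensor.inl ((BiTensor.inr etaR etaL).comp etaR) etaL).comp comul)
      (BiTensor.inr ((BiTensor.inr etaR etaL).comp etaR) etaL)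
      (by
        rw [← BiTensor.inl_comp_eq]
        ext h
        simp only [RingHom.comp_apply, comul_etaR]) (comul x) =
    BiTensor.lift (f := etaR) (g := etaL)
      ((BiTensor.inl ((BiTensor.inr etaR etaL).comp etaR) etaL).comp (BiTensor.inl etaR etaL))
      (BiTensor.lift (f := etaR) (g := etaL)
        ((BiTensor.inl ((BiTensor.inr etaR etaL).comp etaR) etaL).comp (BiTensor.inr etaR etaL))
        (BiTensor.inr ((BiTensor.inr etaR etaL).comp etaR) etaL)
        (by rw [← BiTensor.inl_comp_eq]; rfl) |>.comp comul)
      (by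
        ext h
        simp only [RingHom.comp_apply, comul_etaL, BiTensor.lift_inl, BiTensor.inl_apply_eq])
      (comul x)
  /-- `μ ∘ (c ⊗ id) ∘ Δ = η_R ∘ ε` -/
  antipode_left : ∀ x, BiTensor.lift antipode (RingHom.id A)
    (by rw [antipode_etaR]; rfl) (comul x) = etaR (counit x)
  /-- `μ ∘ (id ⊗ c) ∘ Δ = η_L ∘ ε` -/
  antipode_right : ∀ x, BiTensor.lift (RingHom.id A) antipode
    (by rw [antipode_etaL]; rfl) (comul x) = etaL (counit x)

/-- A Hopf algebroid ideal: `ε(I) = 0`, `Δ(I) ⊆ I ⊗_H A + A ⊗_H I` and `c(I) ⊆ I`. -/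
structure HopfAlgebroid.IsHopfIdeal {H A : Type} [CommRing H] [CommRing A]
    (S : HopfAlgebroid H A) (I : Ideal A) : Prop where
  counit_eq_zero : ∀ x ∈ I, S.counit x = 0
  comul_mem : ∀ x ∈ I, S.comul x ∈
    I.map (BiTensor.inl S.etaR S.etaL) ⊔ I.map (BiTensor.inr S.etaR S.etaL)
  antipode_mem : ∀ x ∈ I, S.antipode x ∈ I

/-- An ideal is homogeneous if it is generated by homogeneous elements. -/
def IsHomogeneousIdeal {ι A : Type} [CommRing A] (gr : ι → AddSubgroup A) (I : Ideal A) : Prop :=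
  ∃ S : Set A, (∀ x ∈ S, ∃ V, x ∈ gr V) ∧ I = Ideal.span S

/-! ## The coefficient ring -/

/-- Generators of the coefficient ring of `H𝔽₂`: the Euler class `a`, the class `u = σ⁻¹`, and the
basis `θ i j = θ / (a^i u^j)` of the negative cone. -/
inductive CoeffGen : Type
  | a : CoeffGen
  | u : CoeffGen
  | theta (i j : ℕ) : CoeffGen

/-- Degrees in `RO(ℤ/2) = ℤ ⊕ ℤα`. -/
def CoeffGen.deg : CoeffGen → ℤ × ℤ
  | .a => (0, -1)
  | .u => (1, -1)
  | .theta i j => (-2 - j, 2 + i + j)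

open CoeffGen in
/-- The relations: `a` and `u` lower the exponents in `θ / (a^i u^j)`, the result being `0` when the
exponent is `0`, and the product of two elements of the negative cone is `0`. -/
inductive CoeffRel : MvPolynomial CoeffGen (ZMod 2) → Prop
  | a_zero (j : ℕ) : CoeffRel (.X a * .X (theta 0 j))
  | a_succ (i j : ℕ) : CoeffRel (.X a * .X (theta (i + 1) j) - .X (theta i j))
  | u_zero (i : ℕ) : CoeffRel (.X u * .X (theta i 0))
  | u_succ (i j : ℕ) : CoeffRel (.X u * .X (theta i (j + 1)) - .X (theta i j))
  | theta_theta (i j k l : ℕ) : CoeffRel (.X (theta i j) * .X (theta k l))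

/-- The coefficient ring `H𝔽₂_⋆^{ℤ/2} = 𝔽₂[a, σ⁻¹] ⊕ 𝔽₂{θ / (a^i σ^{-j})}`. -/
def Coeff : Type := MvPolynomial CoeffGen (ZMod 2) ⧸ Ideal.span {p | CoeffRel p}

namespace Coeff

instance : CommRing Coeff := Ideal.Quotient.commRing _
instance : Algebra (ZMod 2) Coeff := Ideal.Quotient.algebra (ZMod 2)

/-- The projection from the polynomial algebra. -/
def mk : MvPolynomial CoeffGen (ZMod 2) →ₐ[ZMod 2] Coeff :=
  Ideal.Quotient.mkₐ (ZMod 2) (Ideal.span {p | CoeffRel p})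

/-- The class of a generator. -/
def gen (g : CoeffGen) : Coeff := mk (MvPolynomial.X g)

/-- The Euler class. -/
abbrev a : Coeff := gen .a
/-- The class `σ⁻¹`. -/
abbrev u : Coeff := gen .u
/-- The class `θ / (a^i u^j)`. -/
abbrev theta (i j : ℕ) : Coeff := gen (.theta i j)

/-- The part of the coefficient ring in degree `V`. -/
def gr (V : ℤ × ℤ) : Submodule (ZMod 2) Coeff :=
  (MvPolynomial.weightedHomogeneousSubmodule (ZMod 2) CoeffGen.deg V).map mk.toLinearMap

lemma rel_eq_zero {p : MvPolynomial CoeffGen (ZMod 2)} (h : CoeffRel p) :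
    mk p = 0 :=
  Ideal.Quotient.eq_zero_iff_mem.mpr (Ideal.subset_span h)

lemma a_theta_zero (j : ℕ) : a * theta 0 j = 0 := by
  have h := rel_eq_zero (.a_zero j)
  rwa [map_mul] at h
lemma a_theta_succ (i j : ℕ) : a * theta (i + 1) j = theta i j := by
  have h := rel_eq_zero (.a_succ i j)
  rw [map_sub, map_mul, sub_eq_zero] at h
  exact h
lemma u_theta_zero (i : ℕ) : u * theta i 0 = 0 := by
  have h := rel_eq_zero (.u_zero i)
  rwa [map_mul] at h
lemma u_theta_succ (i j : ℕ) : u * theta i (j + 1) = theta i j := by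
  have h := rel_eq_zero (.u_succ i j)
  rw [map_sub, map_mul, sub_eq_zero] at h
  exact h
lemma theta_mul_theta (i j k l : ℕ) : theta i j * theta k l = 0 := by
  have h := rel_eq_zero (.theta_theta i j k l)
  rwa [map_mul] at h

/-- A ring map out of the coefficient ring. -/
def lift {S : Type} [CommRing S] [Algebra (ZMod 2) S] (a' u' : S) (t : ℕ → ℕ → S)
    (h1 : ∀ j, a' * t 0 j = 0) (h2 : ∀ i j, a' * t (i + 1) j = t i j)
    (h3 : ∀ i, u' * t i 0 = 0) (h4 : ∀ i j, u' * t i (j + 1) = t i j)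
    (h5 : ∀ i j k l, t i j * t k l = 0) : Coeff →+* S :=
  Ideal.Quotient.lift _
    (MvPolynomial.aeval (R := ZMod 2)
      (fun g : CoeffGen => CoeffGen.rec a' u' t g)).toRingHom (by
    intro p hp
    rw [← RingHom.mem_ker]
    refine (Ideal.span_le (I := RingHom.ker _)).mpr ?_ hp
    intro q hq
    have key : (MvPolynomial.aeval (R := ZMod 2)
      (fun g : CoeffGen => CoeffGen.rec (motive := fun _ => S) a' u' t g)) q = 0 := by
      cases hq with
      | a_zero j => simpa using h1 j
      | a_succ i j => simpa [sub_eq_zero] using h2 i j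
      | u_zero i => simpa using h3 i
      | u_succ i j => simpa [sub_eq_zero] using h4 i j
      | theta_theta i j k l => simpa using h5 i j k l
    exact key)

section lift

variable {S : Type} [CommRing S] [Algebra (ZMod 2) S] (a' u' : S) (t : ℕ → ℕ → S)
    (h1 : ∀ j, a' * t 0 j = 0) (h2 : ∀ i j, a' * t (i + 1) j = t i j)
    (h3 : ∀ i, u' * t i 0 = 0) (h4 : ∀ i j, u' * t i (j + 1) = t i j)
    (h5 : ∀ i j k l, t i j * t k l = 0)

lemma lift_a : lift a' u' t h1 h2 h3 h4 h5 a = a' :=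
  (Ideal.Quotient.lift_mk _ _ _).trans (MvPolynomial.aeval_X _ _)
lemma lift_u : lift a' u' t h1 h2 h3 h4 h5 u = u' :=
  (Ideal.Quotient.lift_mk _ _ _).trans (MvPolynomial.aeval_X _ _)
lemma lift_theta (i j : ℕ) : lift a' u' t h1 h2 h3 h4 h5 (theta i j) = t i j :=
  (Ideal.Quotient.lift_mk _ _ _).trans (MvPolynomial.aeval_X _ _)

end lift

lemma hom_ext {S : Type} [CommRing S] {f g : Coeff →+* S} (h1 : f a = g a) (h2 : f u = g u)
    (h3 : ∀ i j, f (theta i j) = g (theta i j)) : f = g := by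
  apply Ideal.Quotient.ringHom_ext
  apply MvPolynomial.ringHom_ext
  · intro r
    exact RingHom.congr_fun (RingHom.ext_zmod ((f.comp mk.toRingHom).comp MvPolynomial.C)
      ((g.comp mk.toRingHom).comp MvPolynomial.C)) r
  · rintro (_ | _ | ⟨i, j⟩)
    · exact h1
    · exact h2
    · exact h3 i j

end Coeff

/-! ## Substituting `u + a x` for `u` in the negative cone -/

/-- The expansion of `θ / (a^i (u + a x)^j)`, that is
`∑_{k ≤ i} binom(j + k, k) x^k θ / (a^{i-k} u^{j+k})` (signs are irrelevant modulo 2). -/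
def expand {R : Type} [CommRing R] (t : ℕ → ℕ → R) (x : R) (i j : ℕ) : R :=
  ∑ p ∈ Finset.HasAntidiagonal.antidiagonal i, ((j + p.2).choose p.2 : R) * t p.1 (j + p.2) * x ^ p.2

section expand

variable {R : Type} [CommRing R] (t : ℕ → ℕ → R) (x : R)

lemma expand_zero (i j : ℕ) : expand t 0 i j = t i j := by
  rw [expand, Finset.sum_eq_single (i, 0)]
  · simp
  · rintro ⟨p, k⟩ h hne
    have : k ≠ 0 := by
      rintro rfl
      simp_all
    simp [this]
  · simp

lemma map_expand {S : Type} [CommRing S] (f : R →+* S) (i j : ℕ) :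
    f (expand t x i j) = expand (fun i j => f (t i j)) (f x) i j := by
  simp [expand]

lemma expand_mul_expand (h : ∀ i j k l, t i j * t k l = 0) (i j k l : ℕ) :
    expand t x i j * expand t x k l = 0 := by
  simp only [expand, Finset.sum_mul_sum]
  refine Finset.sum_eq_zero fun p _ => Finset.sum_eq_zero fun q _ => ?_
  linear_combination ((j + p.2).choose p.2 : R) * x ^ p.2 * ((l + q.2).choose q.2 : R) * x ^ q.2 *
    h p.1 (j + p.2) q.1 (l + q.2)

lemma a_expand_zero (a : R) (h : ∀ j, a * t 0 j = 0) (j : ℕ) : a * expand t x 0 j = 0 := by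
  simp [expand, h]

lemma a_expand_succ (a : R) (h : ∀ j, a * t 0 j = 0) (h' : ∀ i j, a * t (i + 1) j = t i j)
    (i j : ℕ) : a * expand t x (i + 1) j = expand t x i j := by
  rw [expand, Finset.Nat.sum_antidiagonal_succ, mul_add, Finset.mul_sum, expand]
  have : a * (((j + (i + 1)).choose (i + 1) : R) * t 0 (j + (i + 1)) * x ^ (i + 1)) = 0 := by
    linear_combination ((j + (i + 1)).choose (i + 1) : R) * x ^ (i + 1) * h (j + (i + 1))
  rw [this, zero_add]
  refine Finset.sum_congr rfl fun p _ => ?_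
  linear_combination ((j + p.2).choose p.2 : R) * x ^ p.2 * h' p.1 (j + p.2)

lemma a_expand (a : R) (h : ∀ j, a * t 0 j = 0) (h' : ∀ i j, a * t (i + 1) j = t i j) (i j : ℕ) :
    a * expand t x i j = match i with
      | 0 => 0
      | i + 1 => expand t x i j := by
  cases i with
  | zero => exact a_expand_zero t x a h j
  | succ i => exact a_expand_succ t x a h h' i j

lemma u_expand_succ (h2 : (2 : R) = 0) (a u : R) (h : ∀ j, a * t 0 j = 0)
    (h' : ∀ i j, a * t (i + 1) j = t i j) (h'' : ∀ i j, u * t i (j + 1) = t i j) (i j : ℕ) :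
    (u + a * x) * expand t x i (j + 1) = expand t x i j := by
  have hu : u * expand t x i (j + 1) = ∑ p ∈ Finset.HasAntidiagonal.antidiagonal i,
      ((j + 1 + p.2).choose p.2 : R) * t p.1 (j + p.2) * x ^ p.2 := by
    rw [expand, Finset.mul_sum]
    refine Finset.sum_congr rfl fun p _ => ?_
    have := h'' p.1 (j + p.2)
    rw [show j + p.2 + 1 = j + 1 + p.2 by ring] at this
    linear_combination ((j + 1 + p.2).choose p.2 : R) * x ^ p.2 * this
  rw [add_mul, hu, mul_assoc, mul_left_comm, a_expand t x a h h']
  cases i with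
  | zero => simp [expand]
  | succ i =>
    simp only [expand]
    rw [Finset.Nat.sum_antidiagonal_succ', Finset.Nat.sum_antidiagonal_succ', Finset.mul_sum,
      add_assoc, ← Finset.sum_add_distrib]
    congr 1
    · simp
    · refine Finset.sum_congr rfl fun p _ => ?_
      have e : ((j + 1 + (p.2 + 1)).choose (p.2 + 1) : R) =
          ((j + 1 + p.2).choose p.2 : R) + ((j + (p.2 + 1)).choose (p.2 + 1) : R) := by
        rw [show j + 1 + (p.2 + 1) = (j + 1 + p.2) + 1 by ring, Nat.choose_succ_succ,
          show j + (p.2 + 1) = j + 1 + p.2 by ring]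
        push_cast
        ring
      rw [e, show j + 1 + p.2 = j + (p.2 + 1) by ring]
      linear_combination ((j + (p.2 + 1)).choose p.2 : R) * t p.1 (j + (p.2 + 1)) * x ^ (p.2 + 1) * h2

lemma u_expand_zero (h2 : (2 : R) = 0) (a u : R) (h : ∀ j, a * t 0 j = 0)
    (h' : ∀ i j, a * t (i + 1) j = t i j) (h3 : ∀ i, u * t i 0 = 0)
    (h'' : ∀ i j, u * t i (j + 1) = t i j) (i : ℕ) :
    (u + a * x) * expand t x i 0 = 0 := by
  rw [add_mul, mul_assoc, mul_left_comm, a_expand t x a h h']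
  cases i with
  | zero => simp [expand, h3]
  | succ i =>
    simp only [expand]
    rw [Finset.Nat.sum_antidiagonal_succ', mul_add, Finset.mul_sum, Finset.mul_sum,
      add_assoc, ← Finset.sum_add_distrib]
    have e : ∀ p ∈ Finset.HasAntidiagonal.antidiagonal i,
        u * (((0 + (p.2 + 1)).choose (p.2 + 1) : R) * t p.1 (0 + (p.2 + 1)) * x ^ (p.2 + 1)) +
        x * (((0 + p.2).choose p.2 : R) * t p.1 (0 + p.2) * x ^ p.2) = 0 := by
      intro p _
      simp only [zero_add, Nat.choose_self, Nat.cast_one]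
      linear_combination x ^ (p.2 + 1) * h'' p.1 p.2 + t p.1 p.2 * x ^ (p.2 + 1) * h2
    rw [Finset.sum_eq_zero e]
    simp [h3]

lemma expand_expand (y : R) (i j : ℕ) : expand (expand t x) y i j = expand t (x + y) i j := by
  have h1 : expand (expand t x) y i j = ∑ q ∈ Finset.HasAntidiagonal.antidiagonal i,
      ∑ p ∈ Finset.HasAntidiagonal.antidiagonal q.1,
        ((j + (p.2 + q.2)).choose (p.2 + q.2) : R) * t p.1 (j + (p.2 + q.2)) *
          (x ^ p.2 * y ^ q.2 * ((p.2 + q.2).choose p.2 : R)) := by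
    rw [expand]
    refine Finset.sum_congr rfl fun q _ => ?_
    rw [expand, Finset.mul_sum, Finset.sum_mul]
    refine Finset.sum_congr rfl fun p _ => ?_
    have e : (((j + q.2).choose q.2 : ℕ) : R) * ((j + q.2 + p.2).choose p.2 : ℕ) =
        ((j + (p.2 + q.2)).choose (p.2 + q.2) : ℕ) * ((p.2 + q.2).choose p.2 : ℕ) := by
      rw [← Nat.cast_mul, ← Nat.cast_mul]
      congr 1
      have := Nat.choose_mul (n := j + (p.2 + q.2)) (k := p.2 + q.2) (s := p.2) (by omega)
      rw [this, mul_comm, show j + (p.2 + q.2) - p.2 = j + q.2 by omega,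
        show p.2 + q.2 - p.2 = q.2 by omega, show j + q.2 + p.2 = j + (p.2 + q.2) by ring]
    rw [show j + q.2 + p.2 = j + (p.2 + q.2) by ring] at e ⊢
    linear_combination t p.1 (j + (p.2 + q.2)) * x ^ p.2 * y ^ q.2 * e
  have h3 : expand t (x + y) i j = ∑ q ∈ Finset.HasAntidiagonal.antidiagonal i,
      ∑ p ∈ Finset.HasAntidiagonal.antidiagonal q.2,
        ((j + (p.1 + p.2)).choose (p.1 + p.2) : R) * t q.1 (j + (p.1 + p.2)) *
          (x ^ p.1 * y ^ p.2 * ((p.1 + p.2).choose p.1 : R)) := by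
    rw [expand]
    refine Finset.sum_congr rfl fun q _ => ?_
    rw [(Commute.all x y).add_pow', Finset.mul_sum]
    refine Finset.sum_congr rfl fun p hp => ?_
    rw [Finset.HasAntidiagonal.mem_antidiagonal.mp hp, nsmul_eq_mul]
    ring
  rw [h1, h3, Finset.sum_sigma', Finset.sum_sigma']
  refine Finset.sum_nbij' (fun s => ⟨(s.2.1, s.2.2 + s.1.2), (s.2.2, s.1.2)⟩)
    (fun s => ⟨(s.1.1 + s.2.1, s.2.2), (s.1.1, s.2.1)⟩) ?_ ?_ ?_ ?_ ?_ <;>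
  · rintro ⟨⟨_, _⟩, ⟨_, _⟩⟩ h
    simp_all [Finset.mem_sigma, Finset.HasAntidiagonal.mem_antidiagonal]
    try omega

end expand

/-! ## The `ℤ/2`-equivariant dual Steenrod algebra -/

/-- The polynomial algebra over the coefficient ring on `ξ_{i+1}` (`Sum.inl i`) and `τ_i`
(`Sum.inr i`), `i ≥ 0`. -/
abbrev EquivPoly : Type := MvPolynomial (ℕ ⊕ ℕ) Coeff

/-- The relations `τ_i² = a τ_{i+1} + η_R(σ⁻¹) ξ_{i+1}`, where `η_R(σ⁻¹) = σ⁻¹ + a τ_0`. -/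
def equivRel (i : ℕ) : EquivPoly :=
  .X (.inr i) ^ 2 - (.C Coeff.a * .X (.inr (i + 1)) +
    (.C Coeff.u + .C Coeff.a * .X (.inr 0)) * .X (.inl i))

/-- The equivariant dual Steenrod algebra `A_⋆`. -/
def EquivDual : Type := EquivPoly ⧸ Ideal.span (Set.range equivRel)

namespace EquivDual

open SeqConv

instance : CommRing EquivDual := Ideal.Quotient.commRing _
instance : Algebra (ZMod 2) EquivDual := Ideal.Quotient.algebra (ZMod 2)

/-- The projection from the polynomial algebra. -/
def mk : EquivPoly →+* EquivDual := Ideal.Quotient.mk _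

/-- Degrees of the generators: `|ξ_i| = (2^i - 1)(1 + α)` and `|τ_i| = (2^i - 1)(1 + α) + 1`. -/
def deg : ℕ ⊕ ℕ → ℤ × ℤ
  | .inl i => (2 ^ (i + 1) - 1, 2 ^ (i + 1) - 1)
  | .inr i => (2 ^ i, 2 ^ i - 1)

/-- The part of `A_⋆` in degree `V ∈ RO(ℤ/2)`. -/
def gr (V : ℤ × ℤ) : AddSubgroup EquivDual :=
  AddSubgroup.closure {x | ∃ W, ∃ r ∈ Coeff.gr W, ∃ d : (ℕ ⊕ ℕ) →₀ ℕ,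
    W + Finsupp.weight deg d = V ∧ x = mk (MvPolynomial.monomial d r)}

/-- `ξ_n`, with `ξ_0 = 1`. -/
def xi : ℕ → EquivDual
  | 0 => 1
  | i + 1 => mk (.X (.inl i))

/-- `τ_n`. -/
def tau (i : ℕ) : EquivDual := mk (.X (.inr i))

/-- The left unit. -/
def etaL : Coeff →+* EquivDual := mk.comp MvPolynomial.C

lemma tau_sq (i : ℕ) :
    tau i ^ 2 = etaL .a * tau (i + 1) + (etaL .u + etaL .a * tau 0) * xi (i + 1) := by
  have h : mk (equivRel i) = 0 :=
    Ideal.Quotient.eq_zero_iff_mem.mpr (Ideal.subset_span ⟨i, rfl⟩)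
  rw [equivRel, map_sub, sub_eq_zero] at h
  simp only [map_pow, map_add, map_mul] at h
  exact h

lemma two_eq_zero {S : Type} [CommRing S] (f : Coeff →+* S) : (2 : S) = 0 := by
  have := map_ofNat f 2
  rw [← this, show (OfNat.ofNat 2 : Coeff) = 0 from ClassicalDual.two_eq_zero, map_zero]

/-- The ring map with prescribed values on the coefficients, on the `ξ_n` and on the `τ_n`. -/
def lift {S : Type} [CommRing S] (f : Coeff →+* S) (x t : ℕ → S)
    (h : ∀ i, t i ^ 2 = f .a * t (i + 1) + (f .u + f .a * t 0) * x (i + 1)) : EquivDual →+* S :=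
  Ideal.Quotient.lift _
    (MvPolynomial.eval₂Hom f (Sum.elim (fun i => x (i + 1)) t)) (by
    intro p hp
    rw [← RingHom.mem_ker]
    refine (Ideal.span_le (I := RingHom.ker _)).mpr ?_ hp
    rintro _ ⟨i, rfl⟩
    simp only [SetLike.mem_coe, RingHom.mem_ker, equivRel, map_sub, map_add, map_mul, map_pow,
      MvPolynomial.eval₂Hom_X', MvPolynomial.eval₂Hom_C, Sum.elim_inl, Sum.elim_inr]
    rw [h, sub_self])

section lift

variable {S : Type} [CommRing S] (f : Coeff →+* S) (x t : ℕ → S)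
    (h : ∀ i, t i ^ 2 = f .a * t (i + 1) + (f .u + f .a * t 0) * x (i + 1))

lemma lift_etaL (r : Coeff) : lift f x t h (etaL r) = f r := by
  refine (Ideal.Quotient.lift_mk _ _ _).trans ?_
  exact MvPolynomial.eval₂Hom_C _ _ _

lemma lift_xi (hx : x 0 = 1) (n : ℕ) : lift f x t h (xi n) = x n := by
  cases n with
  | zero => rw [hx]; exact map_one _
  | succ n =>
    refine (Ideal.Quotient.lift_mk _ _ _).trans ?_
    exact MvPolynomial.eval₂Hom_X' _ _ _

lemma lift_tau (n : ℕ) : lift f x t h (tau n) = t n := by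
  refine (Ideal.Quotient.lift_mk _ _ _).trans ?_
  exact MvPolynomial.eval₂Hom_X' _ _ _

end lift

lemma hom_ext {S : Type} [CommRing S] {f g : EquivDual →+* S} (h1 : ∀ r, f (etaL r) = g (etaL r))
    (h2 : ∀ n, f (xi n) = g (xi n)) (h3 : ∀ n, f (tau n) = g (tau n)) : f = g := by
  apply Ideal.Quotient.ringHom_ext
  apply MvPolynomial.ringHom_ext
  · exact h1
  · rintro (i | i)
    · exact h2 (i + 1)
    · exact h3 i

/-- The right unit: `a ↦ a`, `σ⁻¹ ↦ σ⁻¹ + a τ_0`, and `θ / (a^i u^j) ↦ θ / (a^i (u + a τ_0)^j)`. -/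
def etaR : Coeff →+* EquivDual :=
  have h1 : ∀ j, etaL .a * etaL (.theta 0 j) = 0 := fun j => by
    rw [← map_mul, Coeff.a_theta_zero, map_zero]
  have h2 : ∀ i j, etaL .a * etaL (.theta (i + 1) j) = etaL (.theta i j) := fun i j => by
    rw [← map_mul, Coeff.a_theta_succ]
  have h3 : ∀ i, etaL .u * etaL (.theta i 0) = 0 := fun i => by
    rw [← map_mul, Coeff.u_theta_zero, map_zero]
  have h4 : ∀ i j, etaL .u * etaL (.theta i (j + 1)) = etaL (.theta i j) := fun i j => by
    rw [← map_mul, Coeff.u_theta_succ]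
  have h5 : ∀ i j k l, etaL (.theta i j) * etaL (.theta k l) = 0 := fun i j k l => by
    rw [← map_mul, Coeff.theta_mul_theta, map_zero]
  Coeff.lift (etaL .a) (etaL .u + etaL .a * tau 0) (expand (fun i j => etaL (.theta i j)) (tau 0))
    (a_expand_zero _ _ _ h1) (a_expand_succ _ _ _ h1 h2)
    (u_expand_zero _ _ (two_eq_zero etaL) _ _ h1 h2 h3 h4)
    (u_expand_succ _ _ (two_eq_zero etaL) _ _ h1 h2 h4) (expand_mul_expand _ _ h5)

lemma etaR_a : etaR .a = etaL .a := by
  rw [etaR, Coeff.lift_a]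
lemma etaR_u : etaR .u = etaL .u + etaL .a * tau 0 := by
  rw [etaR, Coeff.lift_u]
lemma etaR_theta (i j : ℕ) :
    etaR (.theta i j) = expand (fun i j => etaL (.theta i j)) (tau 0) i j := by
  rw [etaR, Coeff.lift_theta]

/-- `A_⋆ ⊗_H A_⋆`. -/
abbrev Tensor : Type := BiTensor etaR etaL

/-- `x ↦ x ⊗ 1`. -/
abbrev inl : EquivDual →+* Tensor := BiTensor.inl etaR etaL
/-- `x ↦ 1 ⊗ x`. -/
abbrev inr : EquivDual →+* Tensor := BiTensor.inr etaR etaL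

lemma inl_a : inl (etaL .a) = inr (etaL .a) := by
  rw [← etaR_a]
  exact (BiTensor.inl_apply_eq etaR etaL _).trans (by rw [etaR_a])

lemma inl_u : inl (etaL .u) + inr (etaL .a) * inl (tau 0) = inr (etaL .u) := by
  have h := BiTensor.inl_apply_eq etaR etaL .u
  rw [etaR_u, map_add, map_mul] at h
  rw [← h, ← inl_a]

lemma conv_zero {S : Type} [CommRing S] (x y : ℕ → S) (hx : x 0 = 1) : conv x y 0 = y 0 := by
  simp [conv_eq_sum, hx]

lemma comul_rel (i : ℕ) :
    (conv (fun n => inl (xi n)) (fun n => inr (tau n)) i + inl (tau i)) ^ 2 =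
      (inl.comp etaL) .a * (conv (fun n => inl (xi n)) (fun n => inr (tau n)) (i + 1) +
        inl (tau (i + 1))) +
      ((inl.comp etaL) .u + (inl.comp etaL) .a *
        (conv (fun n => inl (xi n)) (fun n => inr (tau n)) 0 + inl (tau 0))) *
      conv (fun n => inl (xi n)) (fun n => inr (xi n)) (i + 1) := by
  have h2 : (2 : Tensor) = 0 := two_eq_zero (inl.comp etaL)
  have hr : ∀ i, inr (tau i) ^ 2 = inr (etaL .a) * inr (tau (i + 1)) +
      (inr (etaL .u) + inr (etaL .a) * inr (tau 0)) * inr (xi (i + 1)) := by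
    intro i
    rw [← map_pow, tau_sq]
    simp only [map_add, map_mul]
  have hl : inl (tau i) ^ 2 = inl (etaL .a) * inl (tau (i + 1)) +
      (inl (etaL .u) + inl (etaL .a) * inl (tau 0)) * inl (xi (i + 1)) := by
    rw [← map_pow, tau_sq]
    simp only [map_add, map_mul]
  have hc := conv_sq h2 _ _ (fun n => inl (xi n)) (fun n => inr (xi n)) (fun n => inr (tau n)) hr i
  have h0 : inr (xi 0) = 1 := map_one _
  rw [h0] at hc
  simp only [RingHom.comp_apply]
  rw [conv_zero _ _ (map_one inl)]
  rw [inl_a] at hl ⊢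
  rw [inl_u] at hl
  rw [← inl_u] at hl hc
  linear_combination hc + hl +
    (conv (fun n => inl (xi n)) (fun n => inr (tau n)) i * inl (tau i)
      - inl (xi (i + 1)) * inr (etaL .a) * inr (tau 0)) * h2

/-- The coproduct: `Δ ξ_n = ∑_{i + j = n} ξ_i ^ (2 ^ j) ⊗ ξ_j` and
`Δ τ_n = ∑_{i + j = n} ξ_i ^ (2 ^ j) ⊗ τ_j + τ_n ⊗ 1`, left linear over the coefficient ring. -/
def comul : EquivDual →+* Tensor :=
  lift (inl.comp etaL) (conv (fun n => inl (xi n)) (fun n => inr (xi n)))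
    (fun n => conv (fun n => inl (xi n)) (fun n => inr (tau n)) n + inl (tau n)) comul_rel

lemma comul_etaL (r : Coeff) : comul (etaL r) = inl (etaL r) := lift_etaL ..
lemma comul_xi (n : ℕ) : comul (xi n) = conv (fun n => inl (xi n)) (fun n => inr (xi n)) n :=
  lift_xi _ _ _ _ ((conv_zero _ _ (map_one inl)).trans (map_one inr)) n
lemma comul_tau (n : ℕ) : comul (tau n) =
    conv (fun n => inl (xi n)) (fun n => inr (tau n)) n + inl (tau n) := lift_tau ..

/-- The counit: `ε ξ_n = 0` for `n ≥ 1` and `ε τ_n = 0`. -/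
def counit : EquivDual →+* Coeff :=
  lift (RingHom.id _) (one Coeff) 0 (by simp [one])

lemma counit_etaL (r : Coeff) : counit (etaL r) = r := lift_etaL ..
lemma counit_xi (n : ℕ) : counit (xi n) = one Coeff n := lift_xi _ _ _ _ (by simp [one]) n
lemma counit_tau (n : ℕ) : counit (tau n) = 0 := lift_tau ..

lemma counit_etaR (r : Coeff) : counit (etaR r) = r := by
  have h : counit.comp etaR = RingHom.id _ := by
    apply Coeff.hom_ext
    · simp [etaR_a, counit_etaL]
    · simp [etaR_u, counit_etaL, counit_tau]
    · intro i j
      simp [etaR_theta, map_expand, counit_etaL, counit_tau, expand_zero]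
  exact RingHom.congr_fun h r

lemma antipode_rel (i : ℕ) : solve xi tau i ^ 2 = etaR .a * solve xi tau (i + 1) +
    (etaR .u + etaR .a * solve xi tau 0) * solve xi (one EquivDual) (i + 1) := by
  have h2 : (2 : EquivDual) = 0 := two_eq_zero etaL
  rw [solve_zero, etaR_a, etaR_u]
  have hu : etaL .u + etaL .a * tau 0 + etaL .a * tau 0 = etaL .u := by
    linear_combination (etaL .a * tau 0) * h2
  rw [hu]
  refine sq_of_conv h2 _ _ xi (solve xi (one EquivDual)) _ rfl (fun n => ?_) i
  rw [conv_solve _ _ rfl, conv_solve _ _ rfl, tau_sq, solve_zero, solve_zero]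
  simp only [one, Nat.add_eq_zero_iff, one_ne_zero, and_false, if_false, if_true]
  linear_combination (xi (n + 1) * (etaL .u + etaL .a * tau 0)) * h2

/-- The antipode, determined by `c η_L = η_R`, `∑_{i + j = n} ξ_i ^ (2 ^ j) c(ξ_j) = 0` for `n ≥ 1`
and `∑_{i + j = n} ξ_i ^ (2 ^ j) c(τ_j) = τ_n`. -/
def antipode : EquivDual →+* EquivDual :=
  lift etaR (solve xi (one EquivDual)) (solve xi tau) antipode_rel

lemma antipode_etaL (r : Coeff) : antipode (etaL r) = etaR r := lift_etaL ..
lemma antipode_xi (n : ℕ) : antipode (xi n) = solve xi (one EquivDual) n :=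
  lift_xi _ _ _ _ (by simp [solve_zero, one]) n
lemma antipode_tau (n : ℕ) : antipode (tau n) = solve xi tau n := lift_tau ..

lemma antipode_etaR (r : Coeff) : antipode (etaR r) = etaL r := by
  have h2 : (2 : EquivDual) = 0 := two_eq_zero etaL
  have h : antipode.comp etaR = etaL := by
    apply Coeff.hom_ext
    · simp [etaR_a, antipode_etaL]
    · simp only [RingHom.comp_apply, etaR_u, map_add, map_mul, antipode_etaL, etaR_a, antipode_tau,
        solve_zero]
      linear_combination (etaL .a * tau 0) * h2
    · intro i j
      have e : tau 0 + tau 0 = 0 := by linear_combination tau 0 * h2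
      rw [RingHom.comp_apply, etaR_theta, map_expand, antipode_tau, solve_zero]
      simp only [antipode_etaL]
      have : (fun i j => etaR (.theta i j)) = expand (fun i j => etaL (.theta i j)) (tau 0) := by
        funext i j
        exact etaR_theta i j
      rw [this, expand_expand, e, expand_zero]
  exact RingHom.congr_fun h r

lemma comul_etaR (r : Coeff) : comul (etaR r) = inr (etaR r) := by
  have h : comul.comp etaR = inr.comp etaR := by
    apply Coeff.hom_ext
    · simp only [RingHom.comp_apply, etaR_a, comul_etaL, inl_a]
    · simp only [RingHom.comp_apply, etaR_u, map_add, map_mul, comul_etaL, comul_tau]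
      rw [conv_zero _ _ (map_one inl), ← inl_u, inl_a]
      ring
    · intro i j
      simp only [RingHom.comp_apply, etaR_theta, map_expand, comul_etaL, comul_tau]
      rw [conv_zero _ _ (map_one inl)]
      have : (fun i j => inr (etaL (.theta i j))) =
          expand (fun i j => inl (etaL (.theta i j))) (inl (tau 0)) := by
        funext i j
        rw [← map_expand, ← etaR_theta]
        exact (BiTensor.inl_apply_eq etaR etaL _).symm
      rw [this, expand_expand, add_comm]
  exact RingHom.congr_fun h r

lemma comp_apply_eq {S : Type} [CommRing S] (f : Tensor →+* S) (g : EquivDual →+* S)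
    (h : f.comp comul = g) (x : EquivDual) : f (comul x) = g x := RingHom.congr_fun h x

lemma comp_apply_eq' {S : Type} [CommRing S] (f g : Tensor →+* S)
    (h : f.comp comul = g.comp comul) (x : EquivDual) : f (comul x) = g (comul x) :=
  RingHom.congr_fun h x

end EquivDual

open SeqConv EquivDual in
/-- The Hopf algebroid `(H𝔽₂_⋆, A_⋆)`. -/
def equivHopfAlgebroid : HopfAlgebroid Coeff EquivDual where
  etaL := etaL
  etaR := etaR
  comul := comul
  counit := counit
  antipode := antipode
  comul_etaL := comul_etaL
  comul_etaR := comul_etaR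
  counit_etaL := RingHom.ext counit_etaL
  counit_etaR := RingHom.ext counit_etaR
  antipode_etaL := RingHom.ext antipode_etaL
  antipode_etaR := RingHom.ext antipode_etaR
  antipode_antipode := by
    have h2 : (2 : EquivDual) = 0 := two_eq_zero etaL
    have hc : (fun n => antipode (xi n)) = solve xi (one EquivDual) := funext antipode_xi
    have hct : (fun n => antipode (tau n)) = solve xi tau := funext antipode_tau
    have hcc : ∀ n, antipode (antipode (xi n)) = xi n := by
      intro n
      refine congrFun (conv_right_cancel (solve xi (one EquivDual))
        (fun n => antipode (antipode (xi n))) xi (by simp [solve_zero, one]) ?_) n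
      funext m
      rw [solve_conv h2 _ rfl, ← hc, ← map_conv, hc, conv_solve _ _ rfl]
      unfold one
      split <;> simp
    suffices antipode.comp antipode = RingHom.id _ from fun x => RingHom.congr_fun this x
    apply hom_ext
    · intro r
      simp [antipode_etaL, antipode_etaR]
    · exact hcc
    · intro n
      refine congrFun (conv_right_cancel (solve xi (one EquivDual))
        (fun n => antipode (antipode (tau n))) tau (by simp [solve_zero, one]) ?_) n
      have e : conv (solve xi (one EquivDual)) tau = solve xi tau := by
        conv_lhs => rw [← conv_solve xi tau rfl]
        rw [← conv_assoc h2, solve_conv h2 _ rfl, one_conv]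
      funext m
      rw [e, ← hc, ← map_conv, hct, conv_solve _ _ rfl, antipode_tau]
  counit_right := by
    intro x
    refine comp_apply_eq _ (RingHom.id _) ?_ x
    apply hom_ext
    · intro r
      simp only [RingHom.comp_apply, comul_etaL, BiTensor.lift_inl, RingHom.id_apply]
    · intro n
      rw [RingHom.comp_apply, comul_xi, map_conv]
      simp only [BiTensor.lift_inl, BiTensor.lift_inr, RingHom.id_apply, RingHom.comp_apply,
        counit_xi]
      have : (fun i => etaR (one Coeff i)) = one EquivDual := by
        funext i
        unfold one
        split <;> simp
      rw [this, conv_one]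
    · intro n
      rw [RingHom.comp_apply, comul_tau, map_add, map_conv]
      simp only [BiTensor.lift_inl, BiTensor.lift_inr, RingHom.id_apply, RingHom.comp_apply,
        counit_tau, map_zero]
      simp [conv]
  counit_left := by
    intro x
    have h1 : (fun i => etaL (one Coeff i)) = one EquivDual := by
      funext i
      unfold one
      split <;> simp
    refine comp_apply_eq _ (RingHom.id _) ?_ x
    apply hom_ext
    · intro r
      simp only [RingHom.comp_apply, comul_etaL, BiTensor.lift_inl, RingHom.id_apply, counit_etaL]
    · intro n
      rw [RingHom.comp_apply, comul_xi, map_conv]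
      simp only [BiTensor.lift_inl, BiTensor.lift_inr, RingHom.id_apply, RingHom.comp_apply,
        counit_xi]
      rw [h1, one_conv]
    · intro n
      rw [RingHom.comp_apply, comul_tau, map_add, map_conv]
      simp only [BiTensor.lift_inl, BiTensor.lift_inr, RingHom.id_apply, RingHom.comp_apply,
        counit_tau, counit_xi, map_zero]
      rw [h1, one_conv, add_zero]
  coassoc := by
    intro x
    set i12 := BiTensor.inl ((BiTensor.inr etaR etaL).comp etaR) etaL with hi12
    set i3 := BiTensor.inr ((BiTensor.inr etaR etaL).comp etaR) etaL with hi3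
    have h2 : (2 : BiTensor ((BiTensor.inr etaR etaL).comp etaR) etaL) = 0 :=
      two_eq_zero (i3.comp etaL)
    refine comp_apply_eq' _ _ ?_ x
    apply hom_ext
    · intro r
      simp only [RingHom.comp_apply, comul_etaL, BiTensor.lift_inl]
    · intro n
      rw [RingHom.comp_apply, RingHom.comp_apply, comul_xi, map_conv, map_conv]
      simp only [BiTensor.lift_inl, BiTensor.lift_inr, RingHom.comp_apply, comul_xi, map_conv]
      exact congrFun (conv_assoc h2 _ _ _) n
    · intro n
      rw [RingHom.comp_apply, RingHom.comp_apply, comul_tau, map_add, map_add, map_conv, map_conv]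
      simp only [BiTensor.lift_inl, BiTensor.lift_inr, RingHom.comp_apply, comul_xi, comul_tau,
        map_add, map_conv]
      rw [conv_add, ← add_assoc]
      congr 2
      exact congrFun (conv_assoc h2 _ _ _) n
  antipode_left := by
    intro x
    have h2 : (2 : EquivDual) = 0 := two_eq_zero etaL
    refine comp_apply_eq _ (etaR.comp counit) ?_ x
    apply hom_ext
    · intro r
      simp only [RingHom.comp_apply, comul_etaL, BiTensor.lift_inl, antipode_etaL, counit_etaL]
    · intro n
      rw [RingHom.comp_apply, RingHom.comp_apply, comul_xi, map_conv, counit_xi]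
      simp only [BiTensor.lift_inl, BiTensor.lift_inr, RingHom.id_apply, antipode_xi]
      have := congrFun (solve_conv h2 xi rfl) n
      refine this.trans ?_
      unfold one
      split <;> simp
    · intro n
      rw [RingHom.comp_apply, RingHom.comp_apply, comul_tau, map_add, map_conv, counit_tau]
      simp only [BiTensor.lift_inl, BiTensor.lift_inr, RingHom.id_apply, antipode_xi, antipode_tau]
      have e : conv (solve xi (one EquivDual)) tau = solve xi tau := by
        conv_lhs => rw [← conv_solve xi tau rfl]
        rw [← conv_assoc h2, solve_conv h2 _ rfl, one_conv]
      refine (congrArg (· + solve xi tau n) (congrFun e n)).trans ?_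
      rw [map_zero]
      linear_combination solve xi tau n * h2
  antipode_right := by
    intro x
    have h2 : (2 : EquivDual) = 0 := two_eq_zero etaL
    refine comp_apply_eq _ (etaL.comp counit) ?_ x
    apply hom_ext
    · intro r
      simp only [RingHom.comp_apply, comul_etaL, BiTensor.lift_inl, counit_etaL, RingHom.id_apply]
    · intro n
      rw [RingHom.comp_apply, RingHom.comp_apply, comul_xi, map_conv, counit_xi]
      simp only [BiTensor.lift_inl, BiTensor.lift_inr, RingHom.id_apply, antipode_xi]
      refine (congrFun (conv_solve xi (one EquivDual) rfl) n).trans ?_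
      unfold one
      split <;> simp
    · intro n
      rw [RingHom.comp_apply, RingHom.comp_apply, comul_tau, map_add, map_conv, counit_tau]
      simp only [BiTensor.lift_inl, BiTensor.lift_inr, RingHom.id_apply, antipode_tau]
      refine (congrArg (· + tau n) (congrFun (conv_solve xi tau rfl) n)).trans ?_
      rw [map_zero]
      linear_combination tau n * h2

namespace EquivDual

/-- The ideal `I(h, k)` generated by the `ξ_i ^ (2 ^ h(i))`, `i ≥ 1`, and the `τ_i ^ (2 ^ k(i))`,
`i ≥ 0`. -/
def I (h : ℕ+ → ℕ∞) (k : ℕ → ℕ∞) : Ideal EquivDual :=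
  Ideal.span (Set.range (fun i : ℕ+ => powTwo (xi i) (h i)) ∪
    Set.range (fun i : ℕ => powTwo (tau i) (k i)))

/-- The `RO(ℤ/2)`-graded Hopf algebroid ideals of `A_⋆`, ordered by inclusion; `I` stands for the
quotient Hopf algebroid `A_⋆ / I`. -/
abbrev QuotientHopfAlgebroid : Type :=
  {I : Ideal EquivDual // equivHopfAlgebroid.IsHopfIdeal I ∧ IsHomogeneousIdeal gr I}

end EquivDual

end

/-! The classification of the homogeneous Hopf ideals `I` of `A_*` rests on reduced monomials, those
in which every exponent of `ξ_{i+1}` stays below every `2 ^ m` with `ξ_{i+1} ^ (2 ^ m) ∈ I`.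
Non-reduced monomials are multiples of such powers, so it suffices that no reduced monomial occurs
in an element of `I` (`coeff_eq_zero_of_isReduced`); then `I` is generated by the least such powers
(`eq_J_profile`).

The proof is by induction on the internal degree. Take an element of `I`, pass to a homogeneous
component and discard its non-reduced monomials; the result `g` still lies in `I`. If `g` has a
monomial other than some `ξ_n ^ (2 ^ m)`, then `Δ g` has a nonzero coefficient at some `x^b y^c`
with `b`, `c` nonzero and `b + c` in the support of `g` (`exists_coeff_polyComul_ne_zero`). Both `b`
and `c` are reduced of smaller degree, so by induction their coefficient functionals vanish on `I`,
which contradicts that `I` is a coideal. Otherwise `g` has only pure powers; their degrees are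
distinct, so a nonzero `g` is a single `ξ_n ^ (2 ^ m)` in `I`, which is not reduced.

The nonvanishing coefficient comes from the terms of lowest polynomial degree, where `Δ` looks like
`ξ_n ↦ x_n + y_n` and odd binomial coefficients give mixed terms. Pure powers of lower polynomial
degree may cancel such a term: in `ξ_1 ^ 3 + ξ_2` the term `ξ_1 ^ 2 ⊗ ξ_1` cancels. They contribute
only terms whose left exponent is the larger one, so the transposed term, here `ξ_1 ⊗ ξ_1 ^ 2`,
survives.

Projecting to `𝔽₂[ξ_i]` recovers `h(i)` from `J(h)` (`le_of_J_le`). For the second half, `K` is sent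
to the ideal generated by `K` and all `τ_n`. It is a Hopf algebroid ideal because `A_* → A_⋆`
respects counit, coproduct and antipode, and every term of `Δ τ_n` and `c(τ_n)` contains some `τ`.
Order is reflected because `A_* → A_⋆` has a ring retraction that kills the `τ_n`. -/

noncomputable section

namespace ClassicalDual

open MvPolynomial

/-! ### Odd binomial coefficients and splittings of monomials -/

/-- A positive number which is not a power of two has an odd nontrivial binomial coefficient. -/
lemma exists_odd_choose (k : ℕ) (hk : k ≠ 0) (h : ∀ m, k ≠ 2 ^ m) :
    ∃ l, 0 < l ∧ l < k ∧ Odd (k.choose l) := by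
  induction k using Nat.strong_induction_on with
  | _ k ih =>
    rcases Nat.even_or_odd' k with ⟨c, rfl | rfl⟩
    · obtain ⟨l, hl, hlc, ho⟩ := ih c (by omega) (by omega) fun m hm =>
        h (m + 1) (by rw [hm, pow_succ, mul_comm])
      refine ⟨2 * l, by omega, by omega, ?_⟩
      -- Lucas' theorem: `(2c choose 2l)` and `(c choose l)` have the same parity.
      have := Choose.choose_modEq_choose_mod_mul_choose_div_nat (n := 2 * c) (k := 2 * l) (p := 2)
      simp only [Nat.mul_mod_right, Nat.choose_self, one_mul, Nat.mul_div_cancel_left _ two_pos]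
        at this
      rw [Nat.odd_iff] at ho ⊢
      rw [← ho]
      exact this
    · refine ⟨1, one_pos, ?_, by simp⟩
      -- For odd `k` the choice `l = 1` works, and `k ≠ 2 ^ 0` rules out `k = 1`.
      have := h 0
      simp at this
      omega

/-- A monomial of the form `ξ_n ^ (2 ^ m)`. -/
def IsPurePower (s : ℕ →₀ ℕ) : Prop := ∃ n m, s = Finsupp.single n (2 ^ m)

/-- If two variables occur in `r`, the full power of one of them can be split off, with binomial
coefficient 1. If only one occurs, its exponent is not a power of two and `exists_odd_choose`
applies. -/
lemma exists_odd_splitting (r : ℕ →₀ ℕ) (h0 : r ≠ 0) (h : ¬ IsPurePower r) :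
    ∃ (i l : ℕ) (b : ℕ →₀ ℕ), r = Finsupp.single i l + b ∧ l ≠ 0 ∧ b ≠ 0 ∧
      Odd ((r i).choose l) := by
  obtain ⟨i, hi⟩ := Finsupp.ne_iff.mp h0
  by_cases he : r.erase i = 0
  · have hr : r = Finsupp.single i (r i) := by
      conv_lhs => rw [← Finsupp.single_add_erase i r, he, add_zero]
    obtain ⟨l, hl, hlk, ho⟩ := exists_odd_choose (r i) hi fun m hm => h ⟨i, m, by rw [← hm, ← hr]⟩
    refine ⟨i, l, Finsupp.single i (r i - l), ?_, hl.ne', ?_, ho⟩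
    · rw [← Finsupp.single_add, Nat.add_sub_cancel' hlk.le, ← hr]
    · exact Finsupp.single_ne_zero.mpr (Nat.sub_ne_zero_of_lt hlk)
  · exact ⟨i, r i, r.erase i, (Finsupp.single_add_erase i r).symm, hi, he, by simp⟩

/-! ### The additive coproduct -/

/-- The additive coproduct `ξ_n ↦ x_n + y_n`. -/
def additiveComul : MvPolynomial ℕ (ZMod 2) →ₐ[ZMod 2] MvPolynomial (ℕ ⊕ ℕ) (ZMod 2) :=
  aeval fun i => X (Sum.inl i) + X (Sum.inr i)

/-- In the expansion of `∏ (x_j + y_j) ^ s_j`, a term whose only `x`-variable is `x_i` takes `y_j`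
from every factor with `j ≠ i`, and `x_i` from `l` of the `s i` factors with index `i`. The proof
multiplies in one factor at a time. Splittings with a one-variable left part are all that
`exists_odd_splitting` produces, and they involve a single binomial coefficient. -/
lemma coeff_additiveComul_monomial (i : ℕ) (s : ℕ →₀ ℕ) : ∀ (l : ℕ) (b : ℕ →₀ ℕ),
    coeff (Finsupp.sumElim (Finsupp.single i l) b) (additiveComul (monomial s 1)) =
      if s = Finsupp.single i l + b then ((s i).choose l : ZMod 2) else 0 := by
  have hA : ∀ (l : ℕ) (b : ℕ →₀ ℕ) (j : ℕ) (p : MvPolynomial (ℕ ⊕ ℕ) (ZMod 2)),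
      coeff (Finsupp.sumElim (Finsupp.single i l) b) (p * X (Sum.inl j)) =
        if j = i ∧ l ≠ 0 then coeff (Finsupp.sumElim (Finsupp.single i (l - 1)) b) p else 0 := by
    intro l b j p
    rw [coeff_mul_X']
    by_cases hj : j = i
    · subst hj
      have e : Finsupp.sumElim (Finsupp.single j l) b - Finsupp.single (Sum.inl j) 1 =
          Finsupp.sumElim (Finsupp.single j (l - 1)) b := by
        ext (c | c)
        · by_cases hc : c = j <;> simp [hc]
        · simp
      simp [e]
    · simp [hj]
  have hB : ∀ (l : ℕ) (b : ℕ →₀ ℕ) (j : ℕ) (p : MvPolynomial (ℕ ⊕ ℕ) (ZMod 2)),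
      coeff (Finsupp.sumElim (Finsupp.single i l) b) (p * X (Sum.inr j)) =
        if b j ≠ 0 then coeff (Finsupp.sumElim (Finsupp.single i l) (b - Finsupp.single j 1)) p
        else 0 := by
    intro l b j p
    rw [coeff_mul_X']
    have e : Finsupp.sumElim (Finsupp.single i l) b - Finsupp.single (Sum.inr j) 1 =
        Finsupp.sumElim (Finsupp.single i l) (b - Finsupp.single j 1) := by
      ext (c | c)
      · simp
      · simp [Finsupp.single_apply]
    simp [e]
  have step : ∀ (s : ℕ →₀ ℕ) (j : ℕ), (∀ (l : ℕ) (b : ℕ →₀ ℕ),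
      coeff (Finsupp.sumElim (Finsupp.single i l) b) (additiveComul (monomial s 1)) =
        if s = Finsupp.single i l + b then ((s i).choose l : ZMod 2) else 0) →
      ∀ (l : ℕ) (b : ℕ →₀ ℕ), coeff (Finsupp.sumElim (Finsupp.single i l) b)
        (additiveComul (monomial (s + Finsupp.single j 1) 1)) =
        if s + Finsupp.single j 1 = Finsupp.single i l + b then
          (((s + Finsupp.single j 1 : ℕ →₀ ℕ) i).choose l : ZMod 2) else 0 := by
    intro s j ih l b
    have e : additiveComul (monomial (s + Finsupp.single j 1) 1) =
        additiveComul (monomial s 1) * X (Sum.inl j) +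
          additiveComul (monomial s 1) * X (Sum.inr j) := by
      rw [← mul_add, show (monomial (s + Finsupp.single j 1) 1 : MvPolynomial ℕ (ZMod 2)) =
        monomial s 1 * X j by rw [X, monomial_mul, one_mul], map_mul]
      congr 1
      exact aeval_X _ _
    rw [e, coeff_add, hA, hB, ih, ih]
    have h1 : ∀ l', s + Finsupp.single i 1 = Finsupp.single i (l' + 1) + b ↔
        s = Finsupp.single i l' + b := by
      intro l'
      rw [Finsupp.single_add, add_right_comm, add_left_inj]
    have h2 : ∀ b', s + Finsupp.single j 1 = Finsupp.single i l + (b' + Finsupp.single j 1) ↔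
        s = Finsupp.single i l + b' := by
      intro b'
      rw [← add_assoc, add_left_inj]
    by_cases hb : b j = 0
    · rw [if_neg (c := b j ≠ 0) (by simp [hb]), add_zero]
      by_cases hj : j = i
      · subst hj
        cases l with
        | zero =>
          rw [if_neg (by simp), if_neg]
          intro h
          have := DFunLike.congr_fun h j
          simp [hb] at this
        | succ l' =>
          rw [if_pos ⟨rfl, by simp⟩, Nat.add_sub_cancel]
          simp only [h1]
          -- As `b j = 0`, the condition forces `s j = l'`, so both binomial coefficients are 1.
          refine if_ctx_congr Iff.rfl (fun h => ?_) fun _ => rfl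
          have := DFunLike.congr_fun h j
          simp only [Finsupp.add_apply, Finsupp.single_eq_same, hb, add_zero] at this ⊢
          rw [this]
          simp
      · rw [if_neg (by simp [hj]), if_neg]
        intro h
        have := DFunLike.congr_fun h j
        simp [hb, Ne.symm hj] at this
    · obtain ⟨b', rfl⟩ : ∃ b', b = b' + Finsupp.single j 1 :=
        ⟨b - Finsupp.single j 1, by
          ext c
          by_cases hc : c = j
          · subst hc; simp; omega
          · simp [Ne.symm hc]⟩
      rw [if_pos hb, add_tsub_cancel_right]
      simp only [h2]
      by_cases hj : j = i
      · subst hj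
        cases l with
        | zero => simp
        | succ l' =>
          rw [if_pos ⟨rfl, by simp⟩, Nat.add_sub_cancel]
          -- Both terms of the product contribute under the same condition on `s`, and their
          -- binomial coefficients add up by Pascal's rule.
          have h3 : s = Finsupp.single j l' + (b' + Finsupp.single j 1) ↔
              s = Finsupp.single j (l' + 1) + b' := by
            rw [Finsupp.single_add, add_assoc, add_comm b']
          simp only [h3]
          split_ifs
          · rw [Finsupp.add_apply, Finsupp.single_eq_same, Nat.choose_succ_succ, Nat.cast_add]
          · simp
      · rw [if_neg (by simp [hj]), zero_add]
        simp [Ne.symm hj]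
  have multi : ∀ (j k : ℕ) (s : ℕ →₀ ℕ), (∀ (l : ℕ) (b : ℕ →₀ ℕ),
      coeff (Finsupp.sumElim (Finsupp.single i l) b) (additiveComul (monomial s 1)) =
        if s = Finsupp.single i l + b then ((s i).choose l : ZMod 2) else 0) →
      ∀ (l : ℕ) (b : ℕ →₀ ℕ), coeff (Finsupp.sumElim (Finsupp.single i l) b)
        (additiveComul (monomial (s + Finsupp.single j k) 1)) =
        if s + Finsupp.single j k = Finsupp.single i l + b then
          (((s + Finsupp.single j k : ℕ →₀ ℕ) i).choose l : ZMod 2) else 0 := by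
    intro j k s hs
    induction k with
    | zero => simpa using hs
    | succ k ih =>
      rw [Finsupp.single_add, ← add_assoc]
      exact step _ j ih
  induction s using Finsupp.induction with
  | zero =>
    intro l b
    rw [show (monomial 0 1 : MvPolynomial ℕ (ZMod 2)) = 1 from rfl, map_one, coeff_one]
    cases l with
    | zero =>
      by_cases hb : b = 0
      · simp [hb]
      · rw [if_neg, if_neg]
        · simpa using Ne.symm hb
        · intro h
          apply hb
          ext c
          simpa using (DFunLike.congr_fun h (Sum.inr c)).symm
    | succ l =>
      rw [if_neg, if_neg]
      · intro h
        have := DFunLike.congr_fun h i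
        simp at this
        omega
      · intro h
        simpa using DFunLike.congr_fun h (Sum.inl i)
  | single_add j k s _ _ ih =>
    rw [add_comm]
    exact multi j k s ih

/-- The additive coproduct is cocommutative, as can be checked on generators. -/
lemma coeff_additiveComul_swap (p : MvPolynomial ℕ (ZMod 2)) (a b : ℕ →₀ ℕ) :
    coeff (Finsupp.sumElim b a) (additiveComul p) = coeff (Finsupp.sumElim a b) (additiveComul p) := by
  have h : (rename Sum.swap).comp additiveComul = additiveComul := by
    apply MvPolynomial.algHom_ext
    intro i
    simp [additiveComul, add_comm]
  rw [← Finsupp.mapDomain_swap_sumElim a b]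
  conv_lhs => rw [← h]
  exact coeff_rename_mapDomain _ Sum.swap_leftInverse.injective _ _

/-! ### The Milnor coproduct and its lowest-order part -/

/-- The mixed terms of the coproduct of `ξ_{i+1}`. -/
def mixedTerms : ℕ → MvPolynomial (ℕ ⊕ ℕ) (ZMod 2)
  | 0 => 0
  | n + 1 => ∑ p ∈ Finset.HasAntidiagonal.antidiagonal n,
      X (Sum.inl p.1) ^ 2 ^ (p.2 + 1) * X (Sum.inr p.2)

/-- The coproduct of the dual Steenrod algebra, with values in polynomials in two sets of
variables. -/
def polyComul : MvPolynomial ℕ (ZMod 2) →ₐ[ZMod 2] MvPolynomial (ℕ ⊕ ℕ) (ZMod 2) :=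
  aeval fun i => X (Sum.inl i) + X (Sum.inr i) + mixedTerms i

lemma mixedTerms_mem (i : ℕ) : mixedTerms i ∈ idealOfVars (ℕ ⊕ ℕ) (ZMod 2) ^ 2 := by
  cases i with
  | zero => exact zero_mem _
  | succ n =>
    refine sum_mem fun p _ => ?_
    rw [pow_two]
    have hX : ∀ c : ℕ ⊕ ℕ, (X c : MvPolynomial (ℕ ⊕ ℕ) (ZMod 2)) ∈ idealOfVars (ℕ ⊕ ℕ) (ZMod 2) :=
      fun c => Ideal.subset_span ⟨c, rfl⟩
    exact Ideal.mul_mem_mul (Ideal.pow_mem_of_mem _ (hX _) _ (by positivity)) (hX _)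

/-- On a generator the two coproducts differ by mixed terms, which have order at least two. Both are
multiplicative, so the estimate passes to products; this needs the bound on the additive coproduct
as well as the bound on the difference, hence the conjunction. -/
lemma polyComul_sub_additiveComul_mem (s : ℕ →₀ ℕ) :
    additiveComul (monomial s 1) ∈ idealOfVars (ℕ ⊕ ℕ) (ZMod 2) ^ s.degree ∧
    polyComul (monomial s 1) - additiveComul (monomial s 1) ∈
      idealOfVars (ℕ ⊕ ℕ) (ZMod 2) ^ (s.degree + 1) := by
  have hX : ∀ c : ℕ ⊕ ℕ, (X c : MvPolynomial (ℕ ⊕ ℕ) (ZMod 2)) ∈ idealOfVars (ℕ ⊕ ℕ) (ZMod 2) :=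
    fun c => Ideal.subset_span ⟨c, rfl⟩
  have hmul : ∀ s t : ℕ →₀ ℕ, (monomial (s + t) 1 : MvPolynomial ℕ (ZMod 2)) =
      monomial s 1 * monomial t 1 := fun s t => by simp [monomial_mul]
  have key : ∀ s t : ℕ →₀ ℕ, (additiveComul (monomial s 1) ∈ idealOfVars (ℕ ⊕ ℕ) (ZMod 2) ^ s.degree ∧
      polyComul (monomial s 1) - additiveComul (monomial s 1) ∈
        idealOfVars (ℕ ⊕ ℕ) (ZMod 2) ^ (s.degree + 1)) →
      (additiveComul (monomial t 1) ∈ idealOfVars (ℕ ⊕ ℕ) (ZMod 2) ^ t.degree ∧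
      polyComul (monomial t 1) - additiveComul (monomial t 1) ∈
        idealOfVars (ℕ ⊕ ℕ) (ZMod 2) ^ (t.degree + 1)) →
      (additiveComul (monomial (s + t) 1) ∈ idealOfVars (ℕ ⊕ ℕ) (ZMod 2) ^ (s + t).degree ∧
      polyComul (monomial (s + t) 1) - additiveComul (monomial (s + t) 1) ∈
        idealOfVars (ℕ ⊕ ℕ) (ZMod 2) ^ ((s + t).degree + 1)) := by
    rintro s t ⟨hs, hs'⟩ ⟨ht, ht'⟩
    rw [hmul, map_mul, map_mul, map_add]
    refine ⟨by rw [pow_add]; exact Ideal.mul_mem_mul hs ht, ?_⟩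
    have hF : polyComul (monomial s 1) ∈ idealOfVars (ℕ ⊕ ℕ) (ZMod 2) ^ s.degree := by
      have := add_mem (Ideal.pow_le_pow_right (Nat.le_succ _) hs') hs
      rwa [sub_add_cancel] at this
    -- With `F` the Milnor and `G` the additive coproduct: `F F' - G G' = F (F' - G') + (F - G) G'`.
    have e : polyComul (monomial s 1) * polyComul (monomial t 1) -
        additiveComul (monomial s 1) * additiveComul (monomial t 1) =
        polyComul (monomial s 1) * (polyComul (monomial t 1) - additiveComul (monomial t 1)) +
        (polyComul (monomial s 1) - additiveComul (monomial s 1)) *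
          additiveComul (monomial t 1) := by ring
    rw [e]
    refine add_mem ?_ ?_
    · rw [add_assoc, pow_add]
      exact Ideal.mul_mem_mul hF ht'
    · rw [add_right_comm, pow_add]
      exact Ideal.mul_mem_mul hs' ht
  induction s using Finsupp.induction_linear with
  | zero => simp
  | add s t hs ht => exact key s t hs ht
  | single j k =>
    induction k with
    | zero => simp
    | succ k ih =>
      rw [Finsupp.single_add]
      refine key _ _ ih ?_
      have hj : (monomial (Finsupp.single j 1) 1 : MvPolynomial ℕ (ZMod 2)) = X j := rfl
      rw [hj, additiveComul, polyComul, aeval_X, aeval_X, Finsupp.degree_single, pow_one]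
      refine ⟨add_mem (hX _) (hX _), ?_⟩
      rw [add_sub_cancel_left]
      exact mixedTerms_mem j

lemma coeff_polyComul_monomial (s : ℕ →₀ ℕ) (c : ℕ ⊕ ℕ →₀ ℕ) (h : c.degree ≤ s.degree) :
    coeff c (polyComul (monomial s 1)) = coeff c (additiveComul (monomial s 1)) := by
  have := (mem_pow_idealOfVars_iff' _ _).mp (polyComul_sub_additiveComul_mem s).2 c (by omega)
  rwa [coeff_sub, sub_eq_zero] at this

/-- Frobenius is additive, so the coproduct of a `2 ^ m`-th power is obtained by raising each term
of that of the generator to this power. What matters is the asymmetry: in a mixed term the left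
exponent is strictly larger than the right one. -/
lemma coeff_polyComul_purePower {n m : ℕ} {a b : ℕ →₀ ℕ} (ha : a ≠ 0) (hb : b ≠ 0)
    (h : coeff (Finsupp.sumElim a b) (polyComul (monomial (Finsupp.single n (2 ^ m)) 1)) ≠ 0) :
    ∃ j k, a = Finsupp.single j (2 ^ (k + 1 + m)) ∧ b = Finsupp.single k (2 ^ m) := by
  classical
  have inj : ∀ a' b', Finsupp.sumElim a' b' = Finsupp.sumElim a b → a' = a ∧ b' = b := by
    intro a' b' h
    exact ⟨by rw [← Finsupp.comapDomain_inl_sumElim a' b', h, Finsupp.comapDomain_inl_sumElim],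
      by rw [← Finsupp.comapDomain_inr_sumElim a' b', h, Finsupp.comapDomain_inr_sumElim]⟩
  have e : (monomial (Finsupp.single n (2 ^ m)) 1 : MvPolynomial ℕ (ZMod 2)) = X n ^ 2 ^ m :=
    (X_pow_eq_monomial).symm
  have hinl : coeff (Finsupp.sumElim a b)
      (X (Sum.inl n) ^ 2 ^ m : MvPolynomial (ℕ ⊕ ℕ) (ZMod 2)) = 0 := by
    rw [coeff_X_pow, if_neg]
    rw [← Finsupp.sumElim_single_zero]
    exact fun h => hb (inj _ _ h).2.symm
  have hinr : coeff (Finsupp.sumElim a b)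
      (X (Sum.inr n) ^ 2 ^ m : MvPolynomial (ℕ ⊕ ℕ) (ZMod 2)) = 0 := by
    rw [coeff_X_pow, if_neg]
    rw [← Finsupp.sumElim_zero_single]
    exact fun h => ha (inj _ _ h).1.symm
  rw [e, map_pow, polyComul, aeval_X, add_pow_char_pow, add_pow_char_pow, coeff_add, coeff_add, hinl, hinr,
    zero_add, zero_add] at h
  cases n with
  | zero => simp [mixedTerms] at h
  | succ n =>
    rw [mixedTerms, sum_pow_char_pow, coeff_sum] at h
    obtain ⟨p, -, hp⟩ := Finset.exists_ne_zero_of_sum_ne_zero h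
    rw [mul_pow, ← pow_mul, ← pow_add, X_pow_eq_monomial, X_pow_eq_monomial, monomial_mul,
      coeff_monomial, ← Finsupp.sumElim_single_single] at hp
    have := inj _ _ (ite_ne_right_iff.mp hp).1
    exact ⟨p.1, p.2, this.1.symm, this.2.symm⟩

/-- A polynomial with a nonconstant monomial which is not of the form `ξ_n ^ (2 ^ m)` is not
primitive. -/
lemma exists_coeff_polyComul_ne_zero (f : MvPolynomial ℕ (ZMod 2)) (h0 : coeff 0 f = 0)
    (h : ∃ s ∈ f.support, ¬ IsPurePower s) :
    ∃ a b, a ≠ 0 ∧ b ≠ 0 ∧ a + b ∈ f.support ∧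
      coeff (Finsupp.sumElim a b) (polyComul f) ≠ 0 := by
  classical
  obtain ⟨r, hr, hmin⟩ := (f.support.filter fun s => ¬ IsPurePower s).exists_min_image
    Finsupp.degree (by simpa [Finset.Nonempty] using h)
  rw [Finset.mem_filter] at hr
  have hr0 : r ≠ 0 := by
    rintro rfl
    exact (mem_support_iff.mp hr.1) h0
  obtain ⟨i, l, b, hrb, hl, hb, ho⟩ := exists_odd_splitting r hr0 hr.2
  set a := Finsupp.single i l with ha'
  have ha : a ≠ 0 := by simpa [ha'] using hl
  have ho' : ((r i).choose l : ZMod 2) = 1 := by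
    rw [ZMod.natCast_eq_one_iff_odd]; exact ho
  -- For `c` either `(a, b)` or `(b, a)`: monomials of `f` that are not pure powers have degree at
  -- least that of `r`, so only their additive coproduct counts at `c`, and there only `r`
  -- contributes, with coefficient 1. If the total vanishes, some pure power must contribute at `c`.
  have key : ∀ c : ℕ ⊕ ℕ →₀ ℕ, c.degree = r.degree →
      (∀ s, coeff c (additiveComul (monomial s 1)) =
        coeff (Finsupp.sumElim a b) (additiveComul (monomial s 1))) →
      coeff c (polyComul f) = 0 →
      ∃ n m, coeff c (polyComul (monomial (Finsupp.single n (2 ^ m)) 1)) ≠ 0 := by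
    intro c hc hsym hz
    by_contra! hcon
    have hf : f = ∑ s ∈ f.support, coeff s f • monomial s 1 := by
      conv_lhs => rw [f.as_sum]
      simp [smul_monomial]
    rw [hf, map_sum, coeff_sum, Finset.sum_eq_single r] at hz
    · rw [map_smul, coeff_smul, coeff_polyComul_monomial _ _ hc.le, hsym,
        coeff_additiveComul_monomial, if_pos hrb, ho'] at hz
      exact mem_support_iff.mp hr.1 (by simpa using hz)
    · intro s hs hne
      rw [map_smul, coeff_smul]
      by_cases hp : IsPurePower s
      · obtain ⟨n, m, rfl⟩ := hp
        rw [hcon, smul_zero]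
      · have := hmin s (Finset.mem_filter.mpr ⟨hs, hp⟩)
        rw [coeff_polyComul_monomial _ _ (hc.trans_le this), hsym, coeff_additiveComul_monomial,
          if_neg, smul_zero]
        rwa [← hrb]
    · exact fun h => absurd hr.1 h
  have hdeg : ∀ a b : ℕ →₀ ℕ, (Finsupp.sumElim a b).degree = a.degree + b.degree := by
    intro a b
    rw [Finsupp.sumElim_eq_add, map_add, Finsupp.degree_mapDomain, Finsupp.degree_mapDomain]
  by_contra! hcon
  obtain ⟨n, m, h1⟩ := key (Finsupp.sumElim a b) (by rw [hdeg, ← map_add, ← hrb]) (fun _ => rfl)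
    (hcon a b ha hb (by rw [← hrb]; exact hr.1))
  obtain ⟨n', m', h2⟩ := key (Finsupp.sumElim b a)
    (by rw [hdeg, add_comm, ← map_add, ← hrb]) (fun s => coeff_additiveComul_swap _ _ _)
    (hcon b a hb ha (by rw [add_comm, ← hrb]; exact hr.1))
  obtain ⟨j, k, h3, h4⟩ := coeff_polyComul_purePower ha hb h1
  obtain ⟨j', k', h5, h6⟩ := coeff_polyComul_purePower hb ha h2
  -- If the coefficients at `(a, b)` and `(b, a)` both vanish, pure powers contribute at both, so
  -- each of `a` and `b` has larger exponent than the other.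
  have e : ∀ {i j m n : ℕ}, Finsupp.single i (2 ^ m) = Finsupp.single j (2 ^ n) → m = n := by
    intro i j m n h
    have := congrArg Finsupp.degree h
    rw [Finsupp.degree_single, Finsupp.degree_single] at this
    exact Nat.pow_right_injective le_rfl this
  have := e (h3.symm.trans h6)
  have := e (h4.symm.trans h5)
  omega

open SeqConv

/-! ### Coefficients of coproducts as pairings with functionals -/

/-- The coefficient of a monomial, as a linear functional. -/
def coeffₗ (a : ℕ →₀ ℕ) : ClassicalDual →ₗ[ZMod 2] ZMod 2 :=
  (lcoeff (ZMod 2) a : MvPolynomial ℕ (ZMod 2) →ₗ[ZMod 2] ZMod 2)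

/-- The identification of `A_* ⊗ A_*` with polynomials in two sets of variables. -/
def tensorToPoly :
    ClassicalDual ⊗[ZMod 2] ClassicalDual →ₐ[ZMod 2] MvPolynomial (ℕ ⊕ ℕ) (ZMod 2) :=
  Algebra.TensorProduct.productMap
    (rename Sum.inl : MvPolynomial ℕ (ZMod 2) →ₐ[ZMod 2] MvPolynomial (ℕ ⊕ ℕ) (ZMod 2))
    (rename Sum.inr : MvPolynomial ℕ (ZMod 2) →ₐ[ZMod 2] MvPolynomial (ℕ ⊕ ℕ) (ZMod 2))

lemma coeff_rename_mul_rename (a b : ℕ →₀ ℕ) (f g : MvPolynomial ℕ (ZMod 2)) :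
    coeff (Finsupp.sumElim a b) (rename Sum.inl f * rename Sum.inr g) =
      coeff a f * coeff b g := by
  classical
  induction f using MvPolynomial.induction_on' with
  | add p q hp hq => simp only [map_add, add_mul, coeff_add, hp, hq]
  | monomial s c =>
    induction g using MvPolynomial.induction_on' with
    | add p q hp hq => simp only [map_add, mul_add, coeff_add, hp, hq]
    | monomial t d =>
      rw [rename_monomial, rename_monomial, monomial_mul, ← Finsupp.sumElim_eq_add]
      simp only [coeff_monomial]
      have : Finsupp.sumElim s t = Finsupp.sumElim a b ↔ s = a ∧ t = b := by
        refine ⟨fun h => ⟨?_, ?_⟩, by rintro ⟨rfl, rfl⟩; rfl⟩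
        · rw [← Finsupp.comapDomain_inl_sumElim s t, h, Finsupp.comapDomain_inl_sumElim]
        · rw [← Finsupp.comapDomain_inr_sumElim s t, h, Finsupp.comapDomain_inr_sumElim]
      simp only [this]
      split_ifs <;> simp_all

/-- Links the computations with polynomials to the coideal condition: a coefficient of a coproduct
is the value of a tensor product of two coefficient functionals. -/
lemma coeff_tensorToPoly (a b : ℕ →₀ ℕ) (t : ClassicalDual ⊗[ZMod 2] ClassicalDual) :
    coeff (Finsupp.sumElim a b) (tensorToPoly t) =
      LinearMap.mul' (ZMod 2) (ZMod 2) (TensorProduct.map (coeffₗ a) (coeffₗ b) t) := by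
  induction t using TensorProduct.induction_on with
  | zero => simp
  | add x y hx hy => simp only [map_add, coeff_add, hx, hy]
  | tmul f g =>
    rw [TensorProduct.map_tmul, LinearMap.mul'_apply]
    exact coeff_rename_mul_rename a b f g

lemma tensorToPoly_comul (f : MvPolynomial ℕ (ZMod 2)) :
    tensorToPoly (Coalgebra.comul (R := ZMod 2) (show ClassicalDual from f)) = polyComul f := by
  have h : (tensorToPoly.comp comulHom :
      MvPolynomial ℕ (ZMod 2) →ₐ[ZMod 2] MvPolynomial (ℕ ⊕ ℕ) (ZMod 2)) = polyComul := by
    apply MvPolynomial.algHom_ext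
    intro i
    have hx : ∀ n, tensorToPoly (xi (n + 1) ⊗ₜ 1) = X (Sum.inl n) := fun n => by
      refine (Algebra.TensorProduct.productMap_left_apply ..).trans ?_
      exact rename_X _ _
    have hy : ∀ n, tensorToPoly (1 ⊗ₜ xi (n + 1)) = X (Sum.inr n) := fun n => by
      refine (Algebra.TensorProduct.productMap_right_apply ..).trans ?_
      exact rename_X _ _
    have h0 : tensorToPoly (xi 0 ⊗ₜ 1) = 1 := map_one _
    have h0' : tensorToPoly (1 ⊗ₜ xi 0) = 1 := map_one _
    refine (congrArg tensorToPoly (comulHom_xi (i + 1))).trans ?_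
    -- The two extreme terms of the convolution, those with `ξ_0 = 1` on one side, give `x_i + y_i`;
    -- the others are the mixed terms, with both indices shifted by one.
    rw [map_conv', polyComul, aeval_X, conv, Finset.Nat.sum_antidiagonal_succ]
    simp only [hx, hy, h0, one_pow, one_mul]
    cases i with
    | zero => simp [mixedTerms, h0', add_comm]
    | succ n =>
      rw [Finset.Nat.sum_antidiagonal_succ', mixedTerms]
      simp only [hy, h0', pow_zero, pow_one, mul_one]
      ring
  exact DFunLike.congr_fun h f

/-- Functionals which vanish on a coideal pair to zero with its coproducts. -/
lemma map_comul_eq_zero {I : Ideal ClassicalDual} (hI : I.IsHopfIdeal (ZMod 2))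
    (φ ψ : ClassicalDual →ₗ[ZMod 2] ZMod 2) (hφ : ∀ x ∈ I, φ x = 0) (hψ : ∀ x ∈ I, ψ x = 0)
    (x : ClassicalDual) (hx : x ∈ I) :
    TensorProduct.map φ ψ (Coalgebra.comul (R := ZMod 2) x) = 0 := by
  have h := hI.toIsCoideal.map_mkQ_comul_eq_zero (x := x) hx
  -- Both functionals factor through the quotient by `I`, where the coproduct of an element of `I`
  -- vanishes.
  have e : TensorProduct.map φ ψ =
      TensorProduct.map ((I.restrictScalars (ZMod 2)).liftQ φ hφ)
        ((I.restrictScalars (ZMod 2)).liftQ ψ hψ) ∘ₗ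
        TensorProduct.map (I.restrictScalars (ZMod 2)).mkQ (I.restrictScalars (ZMod 2)).mkQ := by
    rw [← TensorProduct.map_comp]
    congr 1
  rw [e, LinearMap.comp_apply, h, map_zero]

/-! ### Reduced monomials and the profile of a Hopf ideal -/

/-- The exponents of `ξ_{i+1}` are less than the least power of two which puts it in `I`. -/
def IsReduced (I : Ideal ClassicalDual) (s : ℕ →₀ ℕ) : Prop :=
  ∀ i m, xi (i + 1) ^ 2 ^ m ∈ I → s i < 2 ^ m

lemma IsReduced.mono {I : Ideal ClassicalDual} {s t : ℕ →₀ ℕ} (ht : IsReduced I t) (h : s ≤ t) :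
    IsReduced I s := fun i m hm => (h i).trans_lt (ht i m hm)

lemma exists_pow_dvd_of_not_isReduced {I : Ideal ClassicalDual} {s : ℕ →₀ ℕ}
    (h : ¬ IsReduced I s) : ∃ i m, xi (i + 1) ^ 2 ^ m ∈ I ∧
      xi (i + 1) ^ 2 ^ m ∣ (show ClassicalDual from monomial s 1) := by
  unfold IsReduced at h
  push Not at h
  obtain ⟨i, m, hm, hs⟩ := h
  refine ⟨i, m, hm, ?_⟩
  have : (X i ^ 2 ^ m : MvPolynomial ℕ (ZMod 2)) ∣ monomial s 1 := by
    rw [X_pow_eq_monomial, monomial_one_dvd_monomial_one]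
    exact Finsupp.single_le_iff.mpr hs
  exact this

lemma counit_eq_coeff_zero (f : MvPolynomial ℕ (ZMod 2)) :
    Coalgebra.counit (R := ZMod 2) (show ClassicalDual from f) = coeff 0 f := by
  have h : (counitHom : MvPolynomial ℕ (ZMod 2) →ₐ[ZMod 2] ZMod 2) = aeval 0 := by
    apply MvPolynomial.algHom_ext
    intro i
    refine (counitHom_xi (i + 1)).trans ?_
    simp [one]
  refine (DFunLike.congr_fun h f).trans ?_
  exact aeval_zero _

/-- The pure powers `ξ_{n+1} ^ (2 ^ m)` have distinct internal degrees: since `2 ^ (n + 1) - 1` is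
odd, the 2-adic valuation of the degree is `m`, and then the odd part gives `n`. -/
lemma eq_of_weight_eq {n m n' m' : ℕ} (h : 2 ^ m * (2 ^ (n + 1) - 1) = 2 ^ m' * (2 ^ (n' + 1) - 1)) :
    n = n' ∧ m = m' := by
  have hodd : ∀ n, ¬ 2 ∣ 2 ^ (n + 1) - 1 := by
    intro n
    have := Nat.one_le_two_pow (n := n)
    rw [pow_succ]
    omega
  have hm : m = m' := by
    have h1 := congrArg (padicValNat 2) h
    have hne : ∀ n, 2 ^ (n + 1) - 1 ≠ 0 := fun n h => hodd n (by rw [h]; exact dvd_zero _)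
    rw [padicValNat.mul (by positivity) (hne _), padicValNat.mul (by positivity) (hne _),
      padicValNat.prime_pow, padicValNat.prime_pow, padicValNat.eq_zero_of_not_dvd (hodd _),
      padicValNat.eq_zero_of_not_dvd (hodd _)] at h1
    simpa using h1
  subst hm
  refine ⟨?_, rfl⟩
  have h1 := Nat.eq_of_mul_eq_mul_left (by positivity) h
  have := Nat.one_le_two_pow (n := n + 1)
  have := Nat.one_le_two_pow (n := n' + 1)
  have h2 : 2 ^ (n + 1) = 2 ^ (n' + 1) := by omega
  have := Nat.pow_right_injective le_rfl h2
  omega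

/-- Reduced monomials do not occur in elements of a homogeneous Hopf ideal. -/
lemma coeff_eq_zero_of_isReduced {I : Ideal ClassicalDual} (hI : I.IsHopfIdeal (ZMod 2))
    (hg : I.IsHomogeneous gr) (d : ℕ) : ∀ a : ℕ →₀ ℕ,
    Finsupp.weight (fun i : ℕ => 2 ^ (i + 1) - 1) a = d → IsReduced I a →
    ∀ f ∈ I, coeffₗ a f = 0 := by
  classical
  induction d using Nat.strong_induction_on with
  | _ d ih =>
  intro a had ha f hf
  -- The constant coefficient is the counit, which vanishes on `I`.
  by_cases ha0 : a = 0
  · subst ha0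
    exact (counit_eq_coeff_zero f).symm.trans (hI.toIsCoideal.counit_eq_zero hf)
  have hwt : ∀ c : ℕ →₀ ℕ, c ≠ 0 → 0 < Finsupp.weight (fun i : ℕ => 2 ^ (i + 1) - 1) c := by
    intro c hc
    obtain ⟨i, hi⟩ := Finsupp.ne_iff.mp hc
    refine lt_of_lt_of_le ?_ (Finsupp.le_weight_of_ne_zero' (w := fun i : ℕ => 2 ^ (i + 1) - 1) hi)
    have := Nat.one_lt_two_pow (n := i + 1) (by omega)
    simp
  -- the homogeneous component of degree `d`, without its non-reduced monomials
  let P : MvPolynomial ℕ (ZMod 2) := weightedHomogeneousComponent (fun i : ℕ => 2 ^ (i + 1) - 1) d f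
  have hP : (show ClassicalDual from P) ∈ I :=
    weightedHomogeneousComponent_mem_of_mem (ZMod 2) (fun i : ℕ => 2 ^ (i + 1) - 1) hg hf d
  have hPc : ∀ s, coeff s P =
      if Finsupp.weight (fun i : ℕ => 2 ^ (i + 1) - 1) s = d then coeffₗ s f else 0 :=
    fun s => coeff_weightedHomogeneousComponent d _ s
  let g : MvPolynomial ℕ (ZMod 2) :=
    ∑ s ∈ P.support.filter (IsReduced I), monomial s (coeff s P)
  have hgc : ∀ s, coeff s g = if IsReduced I s then coeff s P else 0 := by
    intro s
    simp only [g, coeff_sum, coeff_monomial, Finset.sum_ite_eq', Finset.mem_filter,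
      mem_support_iff]
    split_ifs <;> simp_all
  have hgI : (show ClassicalDual from g) ∈ I := by
    -- The discarded monomials are multiples of powers `ξ_{i+1} ^ (2 ^ m)` in `I`, so `g` remains in
    -- `I`.
    have e : P = g + ∑ s ∈ P.support.filter (fun s => ¬ IsReduced I s), monomial s (coeff s P) := by
      conv_lhs => rw [P.as_sum]
      exact (Finset.sum_filter_add_sum_filter_not _ _ _).symm
    have hn : (show ClassicalDual from
        ∑ s ∈ P.support.filter (fun s => ¬ IsReduced I s), monomial s (coeff s P)) ∈ I := by
      refine Ideal.sum_mem (α := ClassicalDual) I fun s hs => ?_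
      obtain ⟨i, m, hm, hd⟩ := exists_pow_dvd_of_not_isReduced (Finset.mem_filter.mp hs).2
      have : (monomial s (coeff s P) : MvPolynomial ℕ (ZMod 2)) =
          C (coeff s P) * monomial s 1 := by simp [C_mul_monomial]
      rw [this]
      exact Ideal.mul_mem_left _ _ (Ideal.mem_of_dvd _ hd hm)
    rw [e] at hP
    exact (Submodule.add_mem_iff_left (p := I) hn).mp hP
  have hgw : ∀ s ∈ g.support, Finsupp.weight (fun i : ℕ => 2 ^ (i + 1) - 1) s = d ∧
      IsReduced I s := by
    intro s hs
    rw [mem_support_iff, hgc] at hs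
    obtain ⟨h1, h2⟩ := ite_ne_right_iff.mp hs
    rw [hPc] at h2
    exact ⟨(ite_ne_right_iff.mp h2).1, h1⟩
  have hga : coeff a g = coeffₗ a f := by
    rw [hgc, if_pos ha, hPc, if_pos had]
  have hg0 : coeff 0 g = 0 :=
    (counit_eq_coeff_zero g).symm.trans (hI.toIsCoideal.counit_eq_zero hgI)
  rw [← hga]
  by_contra hne
  by_cases hpure : ∃ s ∈ g.support, ¬ IsPurePower s
  · obtain ⟨b, c, hb, hc, hbc, hF⟩ := exists_coeff_polyComul_ne_zero g hg0 hpure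
    obtain ⟨hw, hr⟩ := hgw _ hbc
    rw [map_add] at hw
    have := hwt b hb
    have := hwt c hc
    apply hF
    rw [← tensorToPoly_comul, coeff_tensorToPoly, map_comul_eq_zero hI _ _ _ _ _ hgI, map_zero]
    · exact ih _ (by omega) b rfl (hr.mono le_self_add)
    · exact ih _ (by omega) c rfl (hr.mono le_add_self)
  · push Not at hpure
    obtain ⟨n, m, rfl⟩ := hpure a (mem_support_iff.mpr hne)
    -- All monomials of `g` are pure powers of weight `d`, so there is only one, and its nonzero
    -- coefficient in `𝔽₂` is 1.
    have hmono : g = X n ^ 2 ^ m := by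
      have hs : g.support ⊆ {Finsupp.single n (2 ^ m)} := by
        intro s hs
        obtain ⟨n', m', rfl⟩ := hpure s hs
        have := (hgw _ hs).1.trans had.symm
        rw [Finsupp.weight_single, Finsupp.weight_single] at this
        obtain ⟨rfl, rfl⟩ := eq_of_weight_eq this
        simp
      rw [g.as_sum, Finset.sum_subset hs (by simp +contextual), Finset.sum_singleton,
        X_pow_eq_monomial]
      congr 1
      generalize coeff _ g = z at hne
      revert z
      decide
    rw [hmono] at hgI
    have := ha n m hgI
    simp at this

open scoped Classical in
/-- The profile function of an ideal. -/
def profile (I : Ideal ClassicalDual) (i : ℕ+) : ℕ∞ :=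
  if h : ∃ m, xi i ^ 2 ^ m ∈ I then (Nat.find h : ℕ∞) else ⊤

/-- Every monomial of an element of `I` is non-reduced, hence divisible by some `ξ_{i+1} ^ (2 ^ m)`
in `I`, and so by the power of `ξ_{i+1}` with least such `m`, which is a generator of `J (profile
I)`. -/
lemma eq_J_profile {I : Ideal ClassicalDual} (hI : I.IsHopfIdeal (ZMod 2))
    (hg : I.IsHomogeneous gr) : I = J (profile I) := by
  classical
  apply le_antisymm
  · intro f hf
    rw [show f = ∑ s ∈ (show MvPolynomial ℕ (ZMod 2) from f).support,
      (monomial s (coeff s (show MvPolynomial ℕ (ZMod 2) from f)) : MvPolynomial ℕ (ZMod 2)) from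
      MvPolynomial.as_sum _]
    refine Ideal.sum_mem (α := ClassicalDual) _ fun s hs => ?_
    have hs' : ¬ IsReduced I s := fun h =>
      mem_support_iff.mp hs (coeff_eq_zero_of_isReduced hI hg _ s rfl h f hf)
    obtain ⟨i, m, hm, hd⟩ := exists_pow_dvd_of_not_isReduced hs'
    have : ∀ c : ZMod 2, (monomial s c : MvPolynomial ℕ (ZMod 2)) = C c * monomial s 1 := by
      simp [C_mul_monomial]
    rw [this]
    refine Ideal.mul_mem_left _ _ (Ideal.mem_of_dvd _ hd ?_)
    have hex : ∃ m, xi (i.succPNat : ℕ) ^ 2 ^ m ∈ I := ⟨m, hm⟩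
    have hle : Nat.find hex ≤ m := Nat.find_min' hex hm
    have hmem : xi (i + 1) ^ 2 ^ Nat.find hex ∈ J (profile I) := by
      refine Ideal.subset_span ⟨i.succPNat, ?_⟩
      simp only [profile, dif_pos hex]
      rfl
    exact Ideal.mem_of_dvd _ (pow_dvd_pow _ (Nat.pow_le_pow_right two_pos hle)) hmem
  · refine Ideal.span_le.mpr ?_
    rintro _ ⟨i, rfl⟩
    by_cases hex : ∃ m, xi (i : ℕ) ^ 2 ^ m ∈ I
    · simp only [profile, dif_pos hex]
      exact Nat.find_spec hex
    · simp only [profile, dif_neg hex]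
      exact zero_mem I

/-! ### Uniqueness of the profile function -/

/-- The projection to `𝔽₂[ξ_i]`. -/
def projHom (i : ℕ+) : ClassicalDual →ₐ[ZMod 2] Polynomial (ZMod 2) :=
  lift fun n => if n = 0 then 1 else if n = i then Polynomial.X else 0

lemma projHom_xi (i : ℕ+) (n : ℕ) :
    projHom i (xi n) = if n = 0 then 1 else if n = i then Polynomial.X else 0 :=
  lift_xi _ (by simp) n

lemma map_powTwo {R S : Type} [CommRing R] [CommRing S] (f : R →+* S) (x : R) (m : ℕ∞) :
    f (powTwo x m) = powTwo (f x) m := by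
  cases m with
  | top => exact map_zero f
  | coe m => exact map_pow f x _

lemma powTwo_zero {R : Type} [CommRing R] (m : ℕ∞) : powTwo (0 : R) m = 0 := by
  cases m with
  | top => rfl
  | coe m => exact zero_pow (by positivity)

/-- Setting all `ξ_j` with `j ≠ i` to zero sends `J h'` into the ideal generated by `X ^ (2 ^
h'(i))`, so this power divides `X ^ (2 ^ h(i))` in `𝔽₂[X]`. The conventions for `∞` fit: zero
divides no power of `X`. -/
lemma le_of_J_le {h h' : ℕ+ → ℕ∞} (hJ : J h ≤ J h') (i : ℕ+) : h' i ≤ h i := by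
  have h1 : J h' ≤ (Ideal.span {powTwo (Polynomial.X : Polynomial (ZMod 2)) (h' i)}).comap
      (projHom i) := by
    refine Ideal.span_le.mpr ?_
    rintro _ ⟨j, rfl⟩
    refine Ideal.mem_comap.mpr ?_
    have e : projHom i (powTwo (xi j) (h' j)) = powTwo (projHom i (xi j)) (h' j) :=
      map_powTwo (projHom i : ClassicalDual →+* Polynomial (ZMod 2)) _ _
    rw [e, projHom_xi, if_neg j.ne_zero]
    by_cases hij : j = i
    · subst hij
      simp
    · rw [if_neg (by simpa using hij), powTwo_zero]
      exact zero_mem _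
  have h2 := h1 (hJ (Ideal.subset_span ⟨i, rfl⟩))
  have e : projHom i (powTwo (xi i) (h i)) = powTwo Polynomial.X (h i) := by
    refine (map_powTwo (projHom i : ClassicalDual →+* Polynomial (ZMod 2)) _ _).trans ?_
    congr 1
    exact (projHom_xi i i).trans (by simp)
  rw [Ideal.mem_comap, e, Ideal.mem_span_singleton] at h2
  revert h2
  generalize h i = m
  generalize h' i = k
  intro h2
  cases m with
  | top => exact le_top
  | coe m =>
    cases k with
    | top => exact absurd (zero_dvd_iff.mp h2) (pow_ne_zero _ Polynomial.X_ne_zero)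
    | coe k =>
      have := (pow_dvd_pow_iff Polynomial.X_ne_zero Polynomial.not_isUnit_X).mp h2
      exact_mod_cast (Nat.pow_le_pow_iff_right one_lt_two).mp this

lemma J_injective : Function.Injective J := fun _ _ h =>
  funext fun i => le_antisymm (le_of_J_le h.ge i) (le_of_J_le h.le i)

end ClassicalDual

lemma ClassicalDual.ringHom_ext' {S : Type} [CommRing S] {f g : ClassicalDual →+* S}
    (h : ∀ n, f (xi n) = g (xi n)) : f = g := by
  refine MvPolynomial.ringHom_ext (R := ZMod 2) (f := f) (g := g) (fun r => ?_) fun i => h (i + 1)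
  exact RingHom.congr_fun (RingHom.ext_zmod (f.comp (MvPolynomial.C (R := ZMod 2) (σ := ℕ)))
    (g.comp (MvPolynomial.C (R := ZMod 2) (σ := ℕ)))) r

namespace EquivDual

open SeqConv

/-! ### Extending ideals from `A_*` to `A_⋆` -/

/-- The ring map `A_* → A_⋆` with `ξ_n ↦ ξ_n`. -/
def ofClassical : ClassicalDual →ₐ[ZMod 2] EquivDual := ClassicalDual.lift xi

lemma ofClassical_xi (n : ℕ) : ofClassical (.xi n) = xi n := ClassicalDual.lift_xi xi rfl n

/-- The ring map `A_⋆ → A_*` with `ξ_n ↦ ξ_n` which kills the `τ_n` and the generators `a`, `u`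
and `θ i j` of the coefficient ring. -/
def toClassical : EquivDual →+* ClassicalDual :=
  lift (Coeff.lift 0 0 0 (by simp) (by simp) (by simp) (by simp) (by simp)) ClassicalDual.xi 0
    (by intro i; rw [Coeff.lift_a, Coeff.lift_u]; simp)

lemma toClassical_xi (n : ℕ) : toClassical (xi n) = .xi n := lift_xi _ _ _ _ rfl n

lemma toClassical_tau (n : ℕ) : toClassical (tau n) = 0 := lift_tau ..

lemma toClassical_ofClassical (x : ClassicalDual) : toClassical (ofClassical x) = x := by
  have h : toClassical.comp (ofClassical : ClassicalDual →+* EquivDual) = RingHom.id _ :=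
    ClassicalDual.ringHom_ext' fun n =>
      (congrArg toClassical (ofClassical_xi n)).trans (toClassical_xi n)
  exact RingHom.congr_fun h x

/-- The ideal of `A_⋆` generated by an ideal of `A_*` and the `τ_n`. -/
def extend (K : Ideal ClassicalDual) : Ideal EquivDual :=
  K.map ofClassical ⊔ Ideal.span (Set.range tau)

lemma ofClassical_mem_extend {K : Ideal ClassicalDual} {x : ClassicalDual} (hx : x ∈ K) :
    ofClassical x ∈ extend K :=
  Ideal.mem_sup_left (Ideal.mem_map_of_mem _ hx)

lemma tau_mem_extend (K : Ideal ClassicalDual) (n : ℕ) : tau n ∈ extend K :=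
  Ideal.mem_sup_right (Ideal.subset_span ⟨n, rfl⟩)

lemma extend_le {K : Ideal ClassicalDual} {L : Ideal EquivDual}
    (h1 : ∀ x ∈ K, ofClassical x ∈ L) (h2 : ∀ n, tau n ∈ L) : extend K ≤ L :=
  sup_le (Ideal.map_le_iff_le_comap.mpr h1) (Ideal.span_le.mpr (by rintro _ ⟨n, rfl⟩; exact h2 n))

/-- The ring map `toClassical` is a retraction of `ofClassical` and kills the `τ_n`, so it carries
`extend L` back into `L`. -/
lemma extend_le_extend {K L : Ideal ClassicalDual} : extend K ≤ extend L ↔ K ≤ L := by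
  refine ⟨fun h x hx => ?_, fun h => extend_le (fun x hx => ofClassical_mem_extend (h hx))
    (tau_mem_extend L)⟩
  have hL : extend L ≤ L.comap toClassical := by
    refine extend_le (fun y hy => ?_) fun n => ?_
    · rwa [Ideal.mem_comap, toClassical_ofClassical]
    · rw [Ideal.mem_comap, toClassical_tau]
      exact zero_mem _
  have := hL (h (ofClassical_mem_extend hx))
  rwa [Ideal.mem_comap, toClassical_ofClassical] at this

lemma extend_J (h : ℕ+ → ℕ∞) : extend (ClassicalDual.J h) = I h (fun _ => 0) := by
  have e : ∀ i : ℕ+, ofClassical (powTwo (.xi i) (h i)) = powTwo (xi i) (h i) := fun i =>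
    (ClassicalDual.map_powTwo (ofClassical : ClassicalDual →+* EquivDual) _ _).trans
      (congrArg (powTwo · (h i)) (ofClassical_xi i))
  -- The exponent function 0 stands for `τ_i ^ (2 ^ 0) = τ_i`.
  have et : (fun i : ℕ => powTwo (tau i) ((fun _ => 0 : ℕ → ℕ∞) i)) = tau :=
    funext fun i => pow_one (tau i)
  rw [extend, I, Ideal.span_union, et, ClassicalDual.J, Ideal.map_span]
  congr 2
  rw [← Set.range_comp]
  exact congrArg Set.range (funext e)

/-! ### Compatibility with the Hopf structures -/

lemma counit_ofClassical (x : ClassicalDual) :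
    counit (ofClassical x) = algebraMap (ZMod 2) Coeff (Coalgebra.counit (R := ZMod 2) x) := by
  have h : counit.comp (ofClassical : ClassicalDual →+* EquivDual) =
      (algebraMap (ZMod 2) Coeff).comp (ClassicalDual.counitHom : ClassicalDual →+* ZMod 2) := by
    refine ClassicalDual.ringHom_ext' fun n => ?_
    refine (congrArg counit (ofClassical_xi n)).trans ((counit_xi n).trans ?_)
    refine Eq.trans ?_ (congrArg (algebraMap (ZMod 2) Coeff) (ClassicalDual.counitHom_xi n)).symm
    unfold one
    split <;> simp
  exact RingHom.congr_fun h x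

lemma map_solve {R S : Type} [CommRing R] [CommRing S] (f : R →+* S) (x y : ℕ → R) (n : ℕ) :
    f (solve x y n) = solve (fun i => f (x i)) (fun i => f (y i)) n := by
  induction n using Nat.strong_induction_on with
  | _ n ih =>
    rw [solve, solve, map_sub, map_sum]
    congr 1
    refine Finset.sum_congr rfl fun i _ => ?_
    rw [map_mul, map_pow, ih i i.2]

lemma antipode_ofClassical (x : ClassicalDual) :
    antipode (ofClassical x) = ofClassical (HopfAlgebra.antipode (ZMod 2) x) := by
  have h : antipode.comp (ofClassical : ClassicalDual →+* EquivDual) =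
      (ofClassical : ClassicalDual →+* EquivDual).comp
        (ClassicalDual.antipodeHom : ClassicalDual →+* ClassicalDual) := by
    refine ClassicalDual.ringHom_ext' fun n => ?_
    refine (congrArg antipode (ofClassical_xi n)).trans ((antipode_xi n).trans ?_)
    refine Eq.trans ?_ (congrArg ofClassical (ClassicalDual.antipodeHom_xi n)).symm
    refine Eq.trans ?_ (map_solve (ofClassical : ClassicalDual →+* EquivDual) _ _ n).symm
    congr 1
    · exact funext fun i => (ofClassical_xi i).symm
    · funext i
      unfold one
      split <;> simp
  exact RingHom.congr_fun h x

/-- The ring map `A_* ⊗ A_* → A_⋆ ⊗_H A_⋆` induced by `ofClassical`. -/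
def ofClassicalTensor : ClassicalDual ⊗[ZMod 2] ClassicalDual →+* Tensor :=
  -- The left and right inclusions are both `𝔽₂`-linear for this structure, since ring maps out of
  -- `𝔽₂` are unique.
  letI : Algebra (ZMod 2) Tensor := ((inl.comp etaL).comp (algebraMap (ZMod 2) Coeff)).toAlgebra
  let f (g : EquivDual →+* Tensor) : ClassicalDual →ₐ[ZMod 2] Tensor :=
    { g.comp (ofClassical : ClassicalDual →+* EquivDual) with
      commutes' := RingHom.congr_fun (RingHom.ext_zmod
        ((g.comp (ofClassical : ClassicalDual →+* EquivDual)).comp (algebraMap (ZMod 2) _)) _) }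
  (Algebra.TensorProduct.productMap (f inl) (f inr)).toRingHom

lemma ofClassicalTensor_tmul (x y : ClassicalDual) :
    ofClassicalTensor (x ⊗ₜ y) = inl (ofClassical x) * inr (ofClassical y) := rfl

lemma comul_ofClassical (x : ClassicalDual) :
    comul (ofClassical x) = ofClassicalTensor (Coalgebra.comul (R := ZMod 2) x) := by
  have h : comul.comp (ofClassical : ClassicalDual →+* EquivDual) =
      ofClassicalTensor.comp (ClassicalDual.comulHom :
        ClassicalDual →+* ClassicalDual ⊗[ZMod 2] ClassicalDual) := by
    refine ClassicalDual.ringHom_ext' fun n => ?_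
    refine (congrArg comul (ofClassical_xi n)).trans ((comul_xi n).trans ?_)
    refine Eq.trans ?_ (congrArg ofClassicalTensor (ClassicalDual.comulHom_xi n)).symm
    rw [map_conv]
    simp only [ofClassicalTensor_tmul, ofClassical_xi, map_one, mul_one, one_mul]
  exact RingHom.congr_fun h x

/-- Each condition need only be checked on generators: on `K` it is inherited from `A_*`, and on
`τ_n` it follows from the explicit formulas. -/
lemma isHopfIdeal_extend {K : Ideal ClassicalDual} (hK : K.IsHopfIdeal (ZMod 2)) :
    equivHopfAlgebroid.IsHopfIdeal (extend K) where
  counit_eq_zero := by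
    have : extend K ≤ RingHom.ker counit := by
      refine extend_le (fun x hx => ?_) counit_tau
      rw [RingHom.mem_ker, counit_ofClassical, hK.toIsCoideal.counit_eq_zero hx, map_zero]
    exact fun x hx => this hx
  antipode_mem := by
    have : extend K ≤ (extend K).comap antipode := by
      refine extend_le (fun x hx => ?_) fun n => ?_
      · rw [Ideal.mem_comap, antipode_ofClassical]
        exact ofClassical_mem_extend (hK.antipode_mem hx)
      · rw [Ideal.mem_comap, antipode_tau]
        -- The recursion writes `c(τ_n)` as `τ_n` minus multiples of `c(τ_i)` with `i < n`.
        induction n using Nat.strong_induction_on with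
        | _ n ih =>
          rw [solve]
          exact sub_mem (tau_mem_extend K n)
            (sum_mem fun i _ => Ideal.mul_mem_left _ _ (ih i i.2))
    exact fun x hx => this hx
  comul_mem := by
    set L : Ideal Tensor := (extend K).map inl ⊔ (extend K).map inr with hL
    have hl : ∀ x ∈ extend K, inl x ∈ L := fun x hx =>
      Ideal.mem_sup_left (Ideal.mem_map_of_mem _ hx)
    have hr : ∀ x ∈ extend K, inr x ∈ L := fun x hx =>
      Ideal.mem_sup_right (Ideal.mem_map_of_mem _ hx)
    have : extend K ≤ L.comap comul := by
      refine extend_le (fun x hx => ?_) fun n => ?_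
      · rw [Ideal.mem_comap, comul_ofClassical]
        -- The classical coproduct of `x` is a sum of tensors with right factor in `K` and tensors
        -- with left factor in `K`.
        have h := ((Submodule.isCoideal_iff_comul_mem _).mp hK.toIsCoideal).2 x hx
        obtain ⟨y, ⟨y', rfl⟩, z, ⟨z', rfl⟩, e⟩ := Submodule.mem_sup.mp h
        rw [← e, map_add]
        have hadd : ∀ {u v : Tensor}, u ∈ L → v ∈ L → u + v ∈ L := add_mem
        refine hadd ?_ ?_
        · clear e
          induction y' using TensorProduct.induction_on with
          | zero => simp
          | add u v hu hv => rw [map_add, map_add]; exact hadd hu hv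
          | tmul u v =>
            rw [LinearMap.lTensor_tmul, ofClassicalTensor_tmul]
            exact Ideal.mul_mem_left _ _ (hr _ (ofClassical_mem_extend v.2))
        · clear e
          induction z' using TensorProduct.induction_on with
          | zero => simp
          | add u v hu hv => rw [map_add, map_add]; exact hadd hu hv
          | tmul u v =>
            rw [LinearMap.rTensor_tmul, ofClassicalTensor_tmul]
            exact Ideal.mul_mem_right _ _ (hl _ (ofClassical_mem_extend u.2))
      · rw [Ideal.mem_comap, comul_tau]
        -- Every term of `Δ τ_n` has a `τ` as one of its factors.
        exact add_mem (sum_mem fun p _ => Ideal.mul_mem_left _ _ (hr _ (tau_mem_extend K _)))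
          (hl _ (tau_mem_extend K n))
    exact fun x hx => this hx

/-! ### Homogeneity and the order embedding -/

lemma mk_monomial_mem_gr (d : (ℕ ⊕ ℕ) →₀ ℕ) :
    mk (MvPolynomial.monomial d 1) ∈ gr (Finsupp.weight deg d) := by
  refine AddSubgroup.subset_closure ⟨0, 1, ⟨1, ?_, map_one Coeff.mk⟩, d, zero_add _, rfl⟩
  exact MvPolynomial.isWeightedHomogeneous_one _ _

lemma isHomogeneousIdeal_I (h : ℕ+ → ℕ∞) : IsHomogeneousIdeal gr (I h fun _ => 0) := by
  refine ⟨_, ?_, rfl⟩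
  rintro _ (⟨i, rfl⟩ | ⟨i, rfl⟩)
  · obtain ⟨j, hj⟩ : ∃ j, (i : ℕ) = j + 1 := ⟨i - 1, (Nat.succ_pred i.ne_zero).symm⟩
    simp only [hj]
    cases h i with
    -- For `h i = ∞` the generator is zero, which lies in every degree; 0 is an arbitrary choice.
    | top => exact ⟨0, zero_mem _⟩
    | coe m =>
      refine ⟨Finsupp.weight deg (Finsupp.single (.inl j) (2 ^ m)), ?_⟩
      have := mk_monomial_mem_gr (Finsupp.single (.inl j) (2 ^ m))
      rwa [← MvPolynomial.X_pow_eq_monomial, map_pow] at this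
  · refine ⟨Finsupp.weight deg (Finsupp.single (.inr i) 1), ?_⟩
    have : powTwo (tau i) 0 = tau i := pow_one _
    simp only [this]
    exact mk_monomial_mem_gr (Finsupp.single (.inr i) 1)

/-- The assignment `A_* / K ↦ A_⋆ / (K, τ_0, τ_1, …)`. -/
def extendEmbedding : ClassicalDual.QuotientHopfAlgebra ↪o QuotientHopfAlgebroid where
  toFun B := ⟨extend B.1, isHopfIdeal_extend B.2.1, by
    -- The classification supplies explicit homogeneous generators.
    rw [ClassicalDual.eq_J_profile B.2.1 B.2.2, extend_J]
    exact isHomogeneousIdeal_I _⟩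
  inj' B C h := Subtype.ext (le_antisymm
    (extend_le_extend.mp (congrArg Subtype.val h).le)
    (extend_le_extend.mp (congrArg Subtype.val h).ge))
  map_rel_iff' := extend_le_extend

end EquivDual

end

theorem mainTheorem10 :
    (∀ B : ClassicalDual.QuotientHopfAlgebra, ∃! h : ℕ+ → ℕ∞, B.1 = ClassicalDual.J h) ∧
    ∃ Φ : ClassicalDual.QuotientHopfAlgebra ↪o EquivDual.QuotientHopfAlgebroid,
      ∀ (B : ClassicalDual.QuotientHopfAlgebra) (h : ℕ+ → ℕ∞),
        B.1 = ClassicalDual.J h → (Φ B).1 = EquivDual.I h (fun _ => 0) := by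
  refine ⟨fun B => ?_, EquivDual.extendEmbedding, fun B h hB => ?_⟩
  · have e := ClassicalDual.eq_J_profile B.2.1 B.2.2
    exact ⟨_, e, fun h hh => ClassicalDual.J_injective (hh.symm.trans e)⟩
  · rw [← EquivDual.extend_J, ← hB]
    rfl
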